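/- \textbf{Setting.} Consider an infinite-horizon two-player zero-sum partially observable stochastic game: finite sets $S$ of states, $A^1,A^2$ of actions (non-empty) and $Z^1,Z^2$ of private observations; probabilities $P^{z^1,z^2}_{a^1,a^2}(s'\mid s)$ to move from $s$ to $s'$ and to emit $z^1,z^2$ when $a^1,a^2$ are played; a reward $r(s,a^1,a^2)\in\mathbb R$; a discount factor $\gamma\in(0,1)$; and an initial belief $b_0$ on $S$. Player 1 maximizes and player 2 minimizes the expected discounted sum of rewards. Let $\Theta^i_\tau$ be the set of private action--observation histories of player $i$ of length $\tau$. A decision rule $\beta^i_\tau$ maps each $\theta^i\in\Theta^i_\tau$ to a distribution over $A^i$, and a behavioral strategy is a sequence of decision rules, one per time step. An occupancy state $o$ at depth $\tau$ is a probability distribution on $S\times\Theta^1_\tau\times\Theta^2_\tau$ ($O_\tau$ denotes the set of these, and $o_0\in O_0$ is given by $b_0$ and empty histories). Put $$T(o,\beta^1,\beta^2)\bigl(s',(\theta^1,a^1,z^1),(\theta^2,a^2,z^2)\bigr)=\beta^1(\theta^1,a^1)\,\beta^2(\theta^2,a^2)\sum_s P^{z^1,z^2}_{a^1,a^2}(s'\mid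 s)\,o(s,\theta^1,\theta^2),$$ and let $r(o,\beta^1,\beta^2)$ be the expected instant reward in $o$. For $o\in O_\tau$ let $V_\tau(o,\beta^1,\beta^2)=E[\sum_{t\ge\tau}\gamma^{t-\tau}R_t\mid O_\tau=o,\beta^1,\beta^2]$, and let $V^*_\tau(o)$ be the Nash equilibrium value of the zero-sum game $V_\tau(o,\cdot,\cdot)$ in behavioral strategies. \textbf{Algorithm (zs-OMG-HSVI).} Let $\varepsilon>0$; let $\lambda>0$ be a Lipschitz constant, in $1$-norm, of $V^*_\tau$ on $O_\tau$ for every $\tau$; let $0<\rho<\frac{1-\gamma}{2\lambda}\varepsilon$, and put $$thr(\tau)=\gamma^{-\tau}\varepsilon-\sum_{i=1}^{\tau}2\rho\lambda\gamma^{-i}.$$ The algorithm starts from any $L=(L_\tau)$ and $U=(U_\tau)$ with $L_\tau\le V^*_\tau\le U_\tau$ on $O_\tau$ that are $\lambda$-Lipschitz in $1$-norm at each depth and for which $U-L$ is bounded uniformly over all depths. For a function $V$ on occupancy states let $Q^V(o,\beta^1,\beta^2)=r(o,\beta^1,\beta^2)+\gamma V_{\tau+1}(T(o,\beta^1,\beta^2))$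 for $o\in O_\tau$. The procedure $\mathrm{Update}(o)$, for $o\in O_\tau$, replaces $$U_\tau(\omega)\ \text{ by }\ \min\{U_\tau(\omega),\,u+\lambda\|o-\omega\|_1\},\qquad L_\tau(\omega)\ \text{ by }\ \max\{L_\tau(\omega),\,l-\lambda\|o-\omega\|_1\}\qquad(\omega\in O_\tau),$$ where $u=\max_{\beta^1}\min_{\beta^2}Q^U(o,\beta^1,\beta^2)$ and $l=\min_{\beta^2}\max_{\beta^1}Q^L(o,\beta^1,\beta^2)$. The procedure $\mathrm{RecursivelyTry}(o,\tau)$ returns at once if $U_\tau(o)-L_\tau(o)\le thr(\tau)$. Otherwise it performs $\mathrm{Update}(o)$, picks any maximin decision rule $\beta^1$ of $Q^U(o,\cdot,\cdot)$ and any minimax decision rule $\beta^2$ of $Q^L(o,\cdot,\cdot)$, calls $\mathrm{RecursivelyTry}(T(o,\beta^1,\beta^2),\tau+1)$, performs $\mathrm{Update}(o)$ again, and returns. The algorithm calls $\mathrm{RecursivelyTry}(o_0,0)$ (a trial) as long as $U_0(o_0)-L_0(o_0)>\varepsilon$, and then returns $L,U$. \textbf{Theorem.} Each game $V_\tau(o,\cdot,\cdot)$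 has a Nash equilibrium in behavioral strategies, so that $V^*_\tau$ is well defined, and every sufficiently large $\lambda$ is a common Lipschitz constant of the functions $V^*_\tau$. For all $\varepsilon,\lambda,\rho$ and initial bounds as above, and whatever optimal decision rules are picked, the algorithm never gets stuck and terminates after finitely many steps (hence after finitely many trials, each of finite length). The bounds $L,U$ that it returns satisfy $$L_0(o_0)\le V^*_0(o_0)\le U_0(o_0)\quad\text{and}\quad U_0(o_0)-L_0(o_0)\le\varepsilon .$$ -/

import Mathlib

/-- Private action-observation histories of length `τ`: sequences `(a₁, z₁, …, a_τ, z_τ)`. -/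
def Hist.{u, v} (A : Type u) (Z : Type v) : ℕ → Type (max u v)
  | 0 => PUnit.{max u v + 1}
  | τ + 1 => Hist A Z τ × A × Z

instance Hist.instFintype (A Z : Type*) [Fintype A] [Fintype Z] : (τ : ℕ) → Fintype (Hist A Z τ)
  | 0 => inferInstanceAs (Fintype PUnit)
  | τ + 1 =>
    letI := Hist.instFintype A Z τ
    inferInstanceAs (Fintype (Hist A Z τ × A × Z))

/-- A two-player zero-sum partially observable stochastic game with infinite horizon.
`P s a₁ a₂ (s', z₁, z₂)` is the probability to move to `s'` and to emit the private observations
`z₁`, `z₂`; player 1 maximizes, player 2 minimizes the discounted sum of the rewards `r`. -/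
structure POSG (S A₁ A₂ Z₁ Z₂ : Type*) [Fintype S] [Fintype A₁] [Fintype A₂] [Fintype Z₁]
    [Fintype Z₂] where
  P : S → A₁ → A₂ → stdSimplex ℝ (S × Z₁ × Z₂)
  r : S → A₁ → A₂ → ℝ
  γ : ℝ
  γ_nonneg : 0 ≤ γ
  γ_lt_one : γ < 1
  b₀ : stdSimplex ℝ S

/-- Behavioral decision rules at time `τ`: a distribution over actions for every private history. -/
abbrev DecisionRule (A Z : Type*) [Fintype A] (τ : ℕ) : Type _ :=
  Hist A Z τ → stdSimplex ℝ A

/-- Behavioral strategies: one decision rule per time step. From time step `τ` on, only the rules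
of the time steps `t ≥ τ` are used. -/
abbrev Strategy (A Z : Type*) [Fintype A] : Type _ :=
  (t : ℕ) → DecisionRule A Z t

namespace POSG

variable {S A₁ A₂ Z₁ Z₂ : Type*} [Fintype S] [Fintype A₁] [Fintype A₂] [Fintype Z₁] [Fintype Z₂]

/-- Occupancy states at time `τ`: distributions over states and joint histories. -/
abbrev Occ (_G : POSG S A₁ A₂ Z₁ Z₂) (τ : ℕ) : Type _ :=
  stdSimplex ℝ (S × Hist A₁ Z₁ τ × Hist A₂ Z₂ τ)

variable (G : POSG S A₁ A₂ Z₁ Z₂)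

/-- The `1`-norm distance of occupancy states. -/
def l1 {τ : ℕ} (o o' : G.Occ τ) : ℝ := ∑ x, |o.1 x - o'.1 x|

/-- The initial occupancy state: the initial belief, with empty histories. -/
def o₀ : G.Occ 0 :=
  ⟨fun x => G.b₀.1 x.1, fun x => G.b₀.2.1 x.1, by
    rw [Fintype.sum_prod_type]
    refine Eq.trans (Finset.sum_congr rfl fun s _ => ?_) G.b₀.2.2
    change ∑ _y : PUnit × PUnit, G.b₀.1 s = G.b₀.1 s
    simp⟩

/-- The probability of the state and joint history `x` after one more step:
`x` consists of the new state `s'` and of the histories `(θ₁, a₁, z₁)` and `(θ₂, a₂, z₂)`. -/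
def nextFun {τ : ℕ} (o : G.Occ τ) (β₁ : DecisionRule A₁ Z₁ τ) (β₂ : DecisionRule A₂ Z₂ τ)
    (x : S × (Hist A₁ Z₁ τ × A₁ × Z₁) × (Hist A₂ Z₂ τ × A₂ × Z₂)) : ℝ :=
  match x with
  | (s', (θ₁, a₁, z₁), (θ₂, a₂, z₂)) =>
    (β₁ θ₁).1 a₁ * (β₂ θ₂).1 a₂ * ∑ s, (G.P s a₁ a₂).1 (s', z₁, z₂) * o.1 (s, θ₁, θ₂)

theorem nextFun_nonneg {τ : ℕ} (o : G.Occ τ) (β₁ : DecisionRule A₁ Z₁ τ)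
    (β₂ : DecisionRule A₂ Z₂ τ)
    (x : S × (Hist A₁ Z₁ τ × A₁ × Z₁) × (Hist A₂ Z₂ τ × A₂ × Z₂)) :
    0 ≤ G.nextFun o β₁ β₂ x := by
  obtain ⟨s', ⟨θ₁, a₁, z₁⟩, ⟨θ₂, a₂, z₂⟩⟩ := x
  exact mul_nonneg (mul_nonneg ((β₁ θ₁).2.1 a₁) ((β₂ θ₂).2.1 a₂))
    (Finset.sum_nonneg fun s _ => mul_nonneg ((G.P s a₁ a₂).2.1 _) (o.2.1 _))

theorem nextFun_sum {τ : ℕ} (o : G.Occ τ) (β₁ : DecisionRule A₁ Z₁ τ)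
    (β₂ : DecisionRule A₂ Z₂ τ) : ∑ x, G.nextFun o β₁ β₂ x = 1 := by
  have ho : ∑ s, ∑ θ₁, ∑ θ₂, o.1 (s, θ₁, θ₂) = 1 := by
    have := o.2.2
    simpa only [Fintype.sum_prod_type] using this
  let e : S × (Hist A₁ Z₁ τ × A₁ × Z₁) × (Hist A₂ Z₂ τ × A₂ × Z₂) ≃
      ((Hist A₁ Z₁ τ × Hist A₂ Z₂ τ) × (A₁ × A₂)) × (S × Z₁ × Z₂) :=
    { toFun := fun x => (((x.2.1.1, x.2.2.1), (x.2.1.2.1, x.2.2.2.1)), (x.1, x.2.1.2.2, x.2.2.2.2))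
      invFun := fun y => (y.2.1, (y.1.1.1, y.1.2.1, y.2.2.1), (y.1.1.2, y.1.2.2, y.2.2.2))
      left_inv := fun _ => rfl
      right_inv := fun _ => rfl }
  rw [← e.symm.sum_comp, Fintype.sum_prod_type, Fintype.sum_prod_type]
  have h1 : ∀ (θ : Hist A₁ Z₁ τ × Hist A₂ Z₂ τ) (a : A₁ × A₂),
      ∑ y : S × Z₁ × Z₂, G.nextFun o β₁ β₂ (e.symm ((θ, a), y)) =
        (β₁ θ.1).1 a.1 * (β₂ θ.2).1 a.2 * ∑ s, o.1 (s, θ.1, θ.2) := by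
    intro θ a
    change ∑ y : S × Z₁ × Z₂, (β₁ θ.1).1 a.1 * (β₂ θ.2).1 a.2 *
      ∑ s, (G.P s a.1 a.2).1 y * o.1 (s, θ.1, θ.2) = _
    rw [← Finset.mul_sum, Finset.sum_comm]
    simp only [← Finset.sum_mul]
    congr 1
    exact Finset.sum_congr rfl fun s _ => by rw [(G.P s a.1 a.2).2.2, one_mul]
  simp only [h1, Fintype.sum_prod_type, ← Finset.mul_sum, ← Finset.sum_mul]
  simp only [(β₁ _).2.2, (β₂ _).2.2, mul_one, one_mul]
  rw [← ho, Finset.sum_comm (s := Finset.univ (α := S))]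
  refine Finset.sum_congr rfl fun θ₁ _ => ?_
  rw [Finset.sum_comm]

/-- The deterministic transition function of the occupancy Markov game. -/
def next {τ : ℕ} (o : G.Occ τ) (β₁ : DecisionRule A₁ Z₁ τ) (β₂ : DecisionRule A₂ Z₂ τ) :
    G.Occ (τ + 1) :=
  ⟨G.nextFun o β₁ β₂, G.nextFun_nonneg o β₁ β₂, G.nextFun_sum o β₁ β₂⟩

/-- The expected instant reward in an occupancy state under a decision rule profile. -/
def reward {τ : ℕ} (o : G.Occ τ) (β₁ : DecisionRule A₁ Z₁ τ) (β₂ : DecisionRule A₂ Z₂ τ) : ℝ :=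
  ∑ s, ∑ θ₁, ∑ θ₂, o.1 (s, θ₁, θ₂) *
    ∑ a₁, ∑ a₂, (β₁ θ₁).1 a₁ * (β₂ θ₂).1 a₂ * G.r s a₁ a₂

/-- The expected reward `E[R_{τ + n} | O_τ = o, β₁, β₂]`. -/
def expReward (β₁ : Strategy A₁ Z₁) (β₂ : Strategy A₂ Z₂) : ℕ → (τ : ℕ) → G.Occ τ → ℝ
  | 0, τ, o => G.reward o (β₁ τ) (β₂ τ)
  | n + 1, τ, o => expReward β₁ β₂ n (τ + 1) (G.next o (β₁ τ) (β₂ τ))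

/-- The value `E[∑_{t ≥ τ} γ^(t - τ) R_t | O_τ = o, β₁, β₂]` of a strategy profile. -/
noncomputable def value {τ : ℕ} (o : G.Occ τ) (β₁ : Strategy A₁ Z₁) (β₂ : Strategy A₂ Z₂) : ℝ :=
  ∑' n : ℕ, G.γ ^ n * G.expReward β₁ β₂ n τ o

/-- `(β₁, β₂)` is a Nash equilibrium of the subgame at the occupancy state `o`. -/
def IsNash {τ : ℕ} (o : G.Occ τ) (β₁ : Strategy A₁ Z₁) (β₂ : Strategy A₂ Z₂) : Prop :=
  (∀ β₁', G.value o β₁' β₂ ≤ G.value o β₁ β₂) ∧ ∀ β₂', G.value o β₁ β₂ ≤ G.value o β₁ β₂'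

/-- `V*_τ(o)`, the Nash equilibrium value of the subgame at `o`: the number that is the value of
some Nash equilibrium (all of them have the same value). -/
noncomputable def optValue {τ : ℕ} (o : G.Occ τ) : ℝ :=
  Classical.epsilon fun v => ∃ β₁ β₂, G.IsNash o β₁ β₂ ∧ G.value o β₁ β₂ = v

/-- `lam` is a Lipschitz constant (in `1`-norm) of `V*_τ`, common to all time steps `τ`. -/
def IsLipschitzConst (lam : ℝ) : Prop :=
  ∀ (τ : ℕ) (o o' : G.Occ τ), |G.optValue o - G.optValue o'| ≤ lam * G.l1 o o'

/-- Functions assigning a number to every occupancy state of every depth. -/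
abbrev ValueFn : Type _ := (τ : ℕ) → G.Occ τ → ℝ

/-- The local game at `o` whose continuation values are given by `V`. -/
def localGame (V : G.ValueFn) {τ : ℕ} (o : G.Occ τ) (β₁ : DecisionRule A₁ Z₁ τ)
    (β₂ : DecisionRule A₂ Z₂ τ) : ℝ :=
  G.reward o β₁ β₂ + G.γ * V (τ + 1) (G.next o β₁ β₂)

/-- The maximin value of the local game at `o` (used for the upper bound). -/
noncomputable def maximin (V : G.ValueFn) {τ : ℕ} (o : G.Occ τ) : ℝ :=
  ⨆ β₁, ⨅ β₂, G.localGame V o β₁ β₂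

/-- The minimax value of the local game at `o` (used for the lower bound). -/
noncomputable def minimax (V : G.ValueFn) {τ : ℕ} (o : G.Occ τ) : ℝ :=
  ⨅ β₂, ⨆ β₁, G.localGame V o β₁ β₂

/-- `β₁` is an optimal (maximin) decision rule of player 1 in the local game at `o`. -/
def IsMaximin (V : G.ValueFn) {τ : ℕ} (o : G.Occ τ) (β₁ : DecisionRule A₁ Z₁ τ) : Prop :=
  ∀ β₁', (⨅ β₂, G.localGame V o β₁' β₂) ≤ ⨅ β₂, G.localGame V o β₁ β₂

/-- `β₂` is an optimal (minimax) decision rule of player 2 in the local game at `o`. -/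
def IsMinimax (V : G.ValueFn) {τ : ℕ} (o : G.Occ τ) (β₂ : DecisionRule A₂ Z₂ τ) : Prop :=
  ∀ β₂', (⨆ β₁, G.localGame V o β₁ β₂) ≤ ⨆ β₁, G.localGame V o β₁ β₂'

/-- Point-based update of an upper bound at `o`: take the lower envelope of `U` at the depth of `o`
and the downward-pointing cone at `o` with slope `lam` and the value of the local game as summit. -/
noncomputable def updateU (lam : ℝ) (U : G.ValueFn) {τ : ℕ} (o : G.Occ τ) : G.ValueFn :=
  Function.update U τ fun ω => min (U τ ω) (G.maximin U o + lam * G.l1 o ω)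

/-- Point-based update of a lower bound at `o`, with an upward-pointing cone. -/
noncomputable def updateL (lam : ℝ) (L : G.ValueFn) {τ : ℕ} (o : G.Occ τ) : G.ValueFn :=
  Function.update L τ fun ω => max (L τ ω) (G.minimax L o - lam * G.l1 o ω)

/-- The threshold function `thr(τ) = γ^(-τ) ε - ∑_{i=1}^τ 2 ρ λ γ^(-i)`. -/
noncomputable def thr (ε lam ρ : ℝ) (τ : ℕ) : ℝ :=
  (G.γ ^ τ)⁻¹ * ε - ∑ i ∈ Finset.Icc 1 τ, 2 * ρ * lam * (G.γ ^ i)⁻¹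

/-- Configurations of the algorithm zs-OMG-HSVI. All of them hold the current bounds `L`, `U`;
the stack lists the occupancy states whose recursive calls are pending, innermost first. -/
inductive Config (G : POSG S A₁ A₂ Z₁ Z₂)
  /-- evaluate the condition of the while loop -/
  | loop (L U : G.ValueFn)
  /-- call `RecursivelyTry` on `o` -/
  | explore (L U : G.ValueFn) (τ : ℕ) (o : G.Occ τ) (stack : List (Σ t, G.Occ t))
  /-- return from a call of `RecursivelyTry` -/
  | back (L U : G.ValueFn) (stack : List (Σ t, G.Occ t))
  /-- the algorithm has returned `L`, `U` -/
  | done (L U : G.ValueFn)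

/-- One step of the algorithm zs-OMG-HSVI. It is nondeterministic only in the choice among the
optimal decision rules of the local games. -/
inductive Step (G : POSG S A₁ A₂ Z₁ Z₂) (ε lam ρ : ℝ) : G.Config → G.Config → Prop
  /-- the loop condition holds: start a new trial -/
  | startTrial (L U : G.ValueFn) (h : ε < U 0 G.o₀ - L 0 G.o₀) :
      Step G ε lam ρ (.loop L U) (.explore L U 0 G.o₀ [])
  /-- the loop condition fails: return the bounds -/
  | finish (L U : G.ValueFn) (h : U 0 G.o₀ - L 0 G.o₀ ≤ ε) :
      Step G ε lam ρ (.loop L U) (.done L U)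
  /-- the width exceeds the threshold: update, act greedily (player 1 with respect to `U`,
  player 2 with respect to `L`), and call `RecursivelyTry` on the next occupancy state -/
  | descend (L U : G.ValueFn) (τ : ℕ) (o : G.Occ τ) (stack : List (Σ t, G.Occ t))
      (h : G.thr ε lam ρ τ < U τ o - L τ o)
      (β₁ : DecisionRule A₁ Z₁ τ) (h₁ : G.IsMaximin (G.updateU lam U o) o β₁)
      (β₂ : DecisionRule A₂ Z₂ τ) (h₂ : G.IsMinimax (G.updateL lam L o) o β₂) :
      Step G ε lam ρ (.explore L U τ o stack)
        (.explore (G.updateL lam L o) (G.updateU lam U o) (τ + 1) (G.next o β₁ β₂)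
          (⟨τ, o⟩ :: stack))
  /-- the width does not exceed the threshold: return -/
  | cutoff (L U : G.ValueFn) (τ : ℕ) (o : G.Occ τ) (stack : List (Σ t, G.Occ t))
      (h : U τ o - L τ o ≤ G.thr ε lam ρ τ) :
      Step G ε lam ρ (.explore L U τ o stack) (.back L U stack)
  /-- after the recursive call: update again, and return -/
  | backUpdate (L U : G.ValueFn) (τ : ℕ) (o : G.Occ τ) (stack : List (Σ t, G.Occ t)) :
      Step G ε lam ρ (.back L U (⟨τ, o⟩ :: stack))
        (.back (G.updateL lam L o) (G.updateU lam U o) stack)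
  /-- the trial is over -/
  | endTrial (L U : G.ValueFn) : Step G ε lam ρ (.back L U []) (.loop L U)

/-- Admissible initial bounds: they bracket `V*`, are `lam`-Lipschitz at every depth, and have
bounded width. -/
structure IsInit (G : POSG S A₁ A₂ Z₁ Z₂) (lam : ℝ) (L U : G.ValueFn) : Prop where
  lower : ∀ (τ : ℕ) (o : G.Occ τ), L τ o ≤ G.optValue o
  upper : ∀ (τ : ℕ) (o : G.Occ τ), G.optValue o ≤ U τ o
  lipL : ∀ (τ : ℕ) (o o' : G.Occ τ), |L τ o - L τ o'| ≤ lam * G.l1 o o'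
  lipU : ∀ (τ : ℕ) (o o' : G.Occ τ), |U τ o - U τ o'| ≤ lam * G.l1 o o'
  bounded : ∃ W : ℝ, ∀ (τ : ℕ) (o : G.Occ τ), U τ o - L τ o ≤ W

end POSG

/-! Equilibria. Expected rewards are not bilinear in behavioral strategies, but they are in
realization plans (products of the action probabilities along a history). Plans form a convex set by
Kuhn's argument (`Strategy.exists_plan_eq_mix`) and a compact one by Tychonoff, and the discounted
value is continuous there, so Sion's theorem yields a saddle point (`exists_isNash`). For a fixed
profile the value is Lipschitz in the occupancy state, since transitions do not expand the `1`-norm;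
saddle points pass this on to the optimal value.

Correctness. Player 1 secures the optimal value in the local game built on it, and player 2
likewise. Hence summits of the cones lie on the right side of the optimal value, and so do the whole
cones because their slope is a Lipschitz constant (`IsInit.update`).

Termination. The thresholds satisfy `γ * thr (τ + 1) = thr τ - 2 * ρ * lam` and tend to infinity, so
bounded widths stop every trial by a fixed depth `T`. The deepest update, at some `o` of depth `τ`,
brings the width at `o` down to `thr τ - 2 * ρ * lam`. Widths are `2 * lam`-Lipschitz, so the whole
`ρ`-ball around `o` ceases to exceed the threshold. Spaces of occupancy states are compact, so the
packing number of the points above the threshold is finite, and it drops strictly. The sum of these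
numbers over depths below `T` bounds the number of trials. -/

namespace POSG

variable {S A₁ A₂ Z₁ Z₂ : Type*} [Fintype S] [Fintype A₁] [Fintype A₂] [Fintype Z₁] [Fintype Z₂]
variable (G : POSG S A₁ A₂ Z₁ Z₂)

/-! ### Mass transport and the `1`-norm -/

/-- One step of the dynamics on (unnormalized) masses of states and joint histories, without the
probabilities of the actions. -/
def step {τ : ℕ} (m : S × Hist A₁ Z₁ τ × Hist A₂ Z₂ τ → ℝ)
    (x : S × (Hist A₁ Z₁ τ × A₁ × Z₁) × (Hist A₂ Z₂ τ × A₂ × Z₂)) : ℝ :=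
  ∑ s, (G.P s x.2.1.2.1 x.2.2.2.1).1 (x.1, x.2.1.2.2, x.2.2.2.2) * m (s, x.2.1.1, x.2.2.1)

theorem next_apply {τ : ℕ} (o : G.Occ τ) (β₁ : DecisionRule A₁ Z₁ τ) (β₂ : DecisionRule A₂ Z₂ τ)
    (x : S × (Hist A₁ Z₁ τ × A₁ × Z₁) × (Hist A₂ Z₂ τ × A₂ × Z₂)) :
    (G.next o β₁ β₂).1 x =
      (β₁ x.2.1.1).1 x.2.1.2.1 * (β₂ x.2.2.1).1 x.2.2.2.1 * G.step o.1 x := rfl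

/-- Summing over outcomes first, then over actions, every kernel contributes total mass one. No sign
or normalization of `m` is needed, so that `m` can be the pointwise distance of two occupancy
states. -/
theorem sum_step {τ : ℕ} (m : S × Hist A₁ Z₁ τ × Hist A₂ Z₂ τ → ℝ) (β₁ : DecisionRule A₁ Z₁ τ)
    (β₂ : DecisionRule A₂ Z₂ τ) :
    ∑ x : S × (Hist A₁ Z₁ τ × A₁ × Z₁) × (Hist A₂ Z₂ τ × A₂ × Z₂),
      (β₁ x.2.1.1).1 x.2.1.2.1 * (β₂ x.2.2.1).1 x.2.2.2.1 * G.step m x = ∑ x, m x := by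
  let e : S × (Hist A₁ Z₁ τ × A₁ × Z₁) × (Hist A₂ Z₂ τ × A₂ × Z₂) ≃
      ((Hist A₁ Z₁ τ × Hist A₂ Z₂ τ) × (A₁ × A₂)) × (S × Z₁ × Z₂) :=
    { toFun := fun x => (((x.2.1.1, x.2.2.1), (x.2.1.2.1, x.2.2.2.1)), (x.1, x.2.1.2.2, x.2.2.2.2))
      invFun := fun y => (y.2.1, (y.1.1.1, y.1.2.1, y.2.2.1), (y.1.1.2, y.1.2.2, y.2.2.2))
      left_inv := fun _ => rfl
      right_inv := fun _ => rfl }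
  rw [← e.symm.sum_comp, Fintype.sum_prod_type, Fintype.sum_prod_type]
  have h1 : ∀ (θ : Hist A₁ Z₁ τ × Hist A₂ Z₂ τ) (a : A₁ × A₂),
      ∑ y : S × Z₁ × Z₂, ((β₁ (e.symm ((θ, a), y)).2.1.1).1 (e.symm ((θ, a), y)).2.1.2.1 *
        (β₂ (e.symm ((θ, a), y)).2.2.1).1 (e.symm ((θ, a), y)).2.2.2.1 *
        G.step m (e.symm ((θ, a), y))) =
        (β₁ θ.1).1 a.1 * (β₂ θ.2).1 a.2 * ∑ s, m (s, θ.1, θ.2) := by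
    intro θ a
    change ∑ y : S × Z₁ × Z₂, (β₁ θ.1).1 a.1 * (β₂ θ.2).1 a.2 *
      ∑ s, (G.P s a.1 a.2).1 y * m (s, θ.1, θ.2) = _
    rw [← Finset.mul_sum, Finset.sum_comm]
    simp only [← Finset.sum_mul]
    congr 1
    exact Finset.sum_congr rfl fun s _ => by rw [(G.P s a.1 a.2).2.2, one_mul]
  simp only [h1, Fintype.sum_prod_type, ← Finset.mul_sum, ← Finset.sum_mul]
  simp only [(β₁ _).2.2, (β₂ _).2.2, mul_one, one_mul]
  rw [Finset.sum_comm (s := Finset.univ (α := S))]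
  refine Finset.sum_congr rfl fun θ₁ _ => ?_
  rw [Finset.sum_comm]

theorem abs_step_le {τ : ℕ} (m : S × Hist A₁ Z₁ τ × Hist A₂ Z₂ τ → ℝ)
    (x : S × (Hist A₁ Z₁ τ × A₁ × Z₁) × (Hist A₂ Z₂ τ × A₂ × Z₂)) :
    |G.step m x| ≤ G.step (fun y => |m y|) x := by
  refine (Finset.abs_sum_le_sum_abs _ _).trans (Finset.sum_le_sum fun s _ => ?_)
  rw [abs_mul, abs_of_nonneg ((G.P s _ _).2.1 _)]

theorem step_sub {τ : ℕ} (m m' : S × Hist A₁ Z₁ τ × Hist A₂ Z₂ τ → ℝ)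
    (x : S × (Hist A₁ Z₁ τ × A₁ × Z₁) × (Hist A₂ Z₂ τ × A₂ × Z₂)) :
    G.step m x - G.step m' x = G.step (fun y => m y - m' y) x := by
  simp only [step, mul_sub, Finset.sum_sub_distrib]

theorem l1_next_le {τ : ℕ} (o o' : G.Occ τ) (β₁ : DecisionRule A₁ Z₁ τ)
    (β₂ : DecisionRule A₂ Z₂ τ) : G.l1 (G.next o β₁ β₂) (G.next o' β₁ β₂) ≤ G.l1 o o' := by
  have h : ∀ x : S × (Hist A₁ Z₁ τ × A₁ × Z₁) × (Hist A₂ Z₂ τ × A₂ × Z₂),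
      |(G.next o β₁ β₂).1 x - (G.next o' β₁ β₂).1 x| ≤
        (β₁ x.2.1.1).1 x.2.1.2.1 * (β₂ x.2.2.1).1 x.2.2.2.1 *
          G.step (fun y => |o.1 y - o'.1 y|) x := by
    intro x
    rw [next_apply, next_apply, ← mul_sub, step_sub, abs_mul,
      abs_of_nonneg (mul_nonneg ((β₁ _).2.1 _) ((β₂ _).2.1 _))]
    exact mul_le_mul_of_nonneg_left (G.abs_step_le _ x)
      (mul_nonneg ((β₁ _).2.1 _) ((β₂ _).2.1 _))
  exact (Finset.sum_le_sum fun x _ => h x).trans_eq (G.sum_step _ β₁ β₂)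

theorem l1_nonneg {τ : ℕ} (o o' : G.Occ τ) : 0 ≤ G.l1 o o' :=
  Finset.sum_nonneg fun _ _ => abs_nonneg _

theorem l1_self {τ : ℕ} (o : G.Occ τ) : G.l1 o o = 0 := by simp [l1]

theorem l1_comm {τ : ℕ} (o o' : G.Occ τ) : G.l1 o o' = G.l1 o' o :=
  Finset.sum_congr rfl fun _ _ => abs_sub_comm _ _

theorem l1_triangle {τ : ℕ} (o o' o'' : G.Occ τ) : G.l1 o o'' ≤ G.l1 o o' + G.l1 o' o'' := by
  unfold l1
  rw [← Finset.sum_add_distrib]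
  exact Finset.sum_le_sum fun _ _ => abs_sub_le _ _ _

theorem abs_l1_sub_le {τ : ℕ} (o ω ω' : G.Occ τ) : |G.l1 o ω - G.l1 o ω'| ≤ G.l1 ω ω' := by
  rw [abs_sub_le_iff]
  constructor
  · linarith [G.l1_triangle o ω' ω, G.l1_comm ω ω']
  · linarith [G.l1_triangle o ω ω']

theorem continuous_l1 {τ : ℕ} (o : G.Occ τ) : Continuous fun o' : G.Occ τ => G.l1 o o' :=
  continuous_finsetSum _ fun x _ =>
    (continuous_const.sub ((continuous_apply x).comp continuous_subtype_val)).abs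

/-- The metric of `stdSimplex` is the sup-metric; this comparison lets packing numbers in that
metric serve for balls in the `1`-norm. -/
theorem l1_le_dist {τ : ℕ} (o o' : G.Occ τ) :
    G.l1 o o' ≤ Fintype.card (S × Hist A₁ Z₁ τ × Hist A₂ Z₂ τ) * dist o o' := by
  unfold l1
  rw [← nsmul_eq_mul, ← Finset.card_univ]
  refine Finset.sum_le_card_nsmul _ _ _ fun x _ => ?_
  rw [← Real.dist_eq, Subtype.dist_eq]
  exact dist_le_pi_dist o.1 o'.1 x

/-! ### Rewards and values -/

/-- A bound of all rewards. -/
def rewardBound : ℝ := ∑ s, ∑ a₁, ∑ a₂, |G.r s a₁ a₂|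

theorem rewardBound_nonneg : 0 ≤ G.rewardBound :=
  Finset.sum_nonneg fun _ _ => Finset.sum_nonneg fun _ _ => Finset.sum_nonneg fun _ _ =>
    abs_nonneg _

/-- The expected instant reward given the state and the joint history. -/
def condReward {τ : ℕ} (β₁ : DecisionRule A₁ Z₁ τ) (β₂ : DecisionRule A₂ Z₂ τ)
    (x : S × Hist A₁ Z₁ τ × Hist A₂ Z₂ τ) : ℝ :=
  ∑ a₁, ∑ a₂, (β₁ x.2.1).1 a₁ * (β₂ x.2.2).1 a₂ * G.r x.1 a₁ a₂

theorem reward_eq_sum {τ : ℕ} (o : G.Occ τ) (β₁ : DecisionRule A₁ Z₁ τ)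
    (β₂ : DecisionRule A₂ Z₂ τ) : G.reward o β₁ β₂ = ∑ x, o.1 x * G.condReward β₁ β₂ x := by
  simp only [reward, condReward, Fintype.sum_prod_type]

theorem apply_le_one {ι : Type*} [Fintype ι] (p : stdSimplex ℝ ι) (i : ι) : p.1 i ≤ 1 := by
  rw [← p.2.2]
  exact Finset.single_le_sum (f := p.1) (fun j _ => p.2.1 j) (Finset.mem_univ i)

theorem abs_condReward_le {τ : ℕ} (β₁ : DecisionRule A₁ Z₁ τ) (β₂ : DecisionRule A₂ Z₂ τ)
    (x : S × Hist A₁ Z₁ τ × Hist A₂ Z₂ τ) : |G.condReward β₁ β₂ x| ≤ G.rewardBound := by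
  have h : |G.condReward β₁ β₂ x| ≤ ∑ a₁, ∑ a₂, |G.r x.1 a₁ a₂| := by
    refine (Finset.abs_sum_le_sum_abs _ _).trans (Finset.sum_le_sum fun a₁ _ => ?_)
    refine (Finset.abs_sum_le_sum_abs _ _).trans (Finset.sum_le_sum fun a₂ _ => ?_)
    have h1 := (β₁ x.2.1).2.1 a₁
    have h2 := (β₂ x.2.2).2.1 a₂
    rw [abs_mul, abs_of_nonneg (mul_nonneg h1 h2)]
    exact mul_le_of_le_one_left (abs_nonneg _)
      (mul_le_one₀ (apply_le_one _ _) h2 (apply_le_one _ _))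
  exact h.trans (Finset.single_le_sum (f := fun s => ∑ a₁, ∑ a₂, |G.r s a₁ a₂|)
    (fun _ _ => Finset.sum_nonneg fun _ _ => Finset.sum_nonneg fun _ _ => abs_nonneg _)
    (Finset.mem_univ x.1))

theorem abs_reward_le {τ : ℕ} (o : G.Occ τ) (β₁ : DecisionRule A₁ Z₁ τ)
    (β₂ : DecisionRule A₂ Z₂ τ) : |G.reward o β₁ β₂| ≤ G.rewardBound := by
  rw [reward_eq_sum, ← one_mul G.rewardBound, ← o.2.2, Finset.sum_mul]
  refine (Finset.abs_sum_le_sum_abs _ _).trans (Finset.sum_le_sum fun x _ => ?_)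
  rw [abs_mul, abs_of_nonneg (o.2.1 x)]
  exact mul_le_mul_of_nonneg_left (G.abs_condReward_le β₁ β₂ x) (o.2.1 x)

theorem abs_reward_sub_le {τ : ℕ} (o o' : G.Occ τ) (β₁ : DecisionRule A₁ Z₁ τ)
    (β₂ : DecisionRule A₂ Z₂ τ) :
    |G.reward o β₁ β₂ - G.reward o' β₁ β₂| ≤ G.rewardBound * G.l1 o o' := by
  rw [reward_eq_sum, reward_eq_sum, ← Finset.sum_sub_distrib, l1, Finset.mul_sum]
  refine (Finset.abs_sum_le_sum_abs _ _).trans (Finset.sum_le_sum fun x _ => ?_)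
  rw [← sub_mul, abs_mul, mul_comm]
  exact mul_le_mul_of_nonneg_right (G.abs_condReward_le β₁ β₂ x) (abs_nonneg _)

theorem abs_expReward_le (β₁ : Strategy A₁ Z₁) (β₂ : Strategy A₂ Z₂) (n τ : ℕ) (o : G.Occ τ) :
    |G.expReward β₁ β₂ n τ o| ≤ G.rewardBound := by
  induction n generalizing τ with
  | zero => exact G.abs_reward_le o _ _
  | succ n ih => exact ih _ _

theorem abs_expReward_sub_le (β₁ : Strategy A₁ Z₁) (β₂ : Strategy A₂ Z₂) (n τ : ℕ)
    (o o' : G.Occ τ) :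
    |G.expReward β₁ β₂ n τ o - G.expReward β₁ β₂ n τ o'| ≤ G.rewardBound * G.l1 o o' := by
  induction n generalizing τ with
  | zero => exact G.abs_reward_sub_le o o' _ _
  | succ n ih =>
    exact (ih _ _ _).trans (mul_le_mul_of_nonneg_left (G.l1_next_le _ _ _ _) G.rewardBound_nonneg)

theorem expReward_congr {β₁ β₁' : Strategy A₁ Z₁} {β₂ β₂' : Strategy A₂ Z₂} (n τ : ℕ)
    (o : G.Occ τ) (h₁ : ∀ t, τ ≤ t → β₁ t = β₁' t) (h₂ : ∀ t, τ ≤ t → β₂ t = β₂' t) :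
    G.expReward β₁ β₂ n τ o = G.expReward β₁' β₂' n τ o := by
  induction n generalizing τ with
  | zero => simp only [expReward, h₁ τ le_rfl, h₂ τ le_rfl]
  | succ n ih =>
    simp only [expReward, h₁ τ le_rfl, h₂ τ le_rfl]
    exact ih _ _ (fun t ht => h₁ t (by omega)) (fun t ht => h₂ t (by omega))

theorem value_congr {β₁ β₁' : Strategy A₁ Z₁} {β₂ β₂' : Strategy A₂ Z₂} {τ : ℕ}
    (o : G.Occ τ) (h₁ : ∀ t, τ ≤ t → β₁ t = β₁' t) (h₂ : ∀ t, τ ≤ t → β₂ t = β₂' t) :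
    G.value o β₁ β₂ = G.value o β₁' β₂' :=
  tsum_congr fun n => by rw [G.expReward_congr n τ o h₁ h₂]

theorem summable_discounted {u : ℕ → ℝ} {C : ℝ} (hu : ∀ n, |u n| ≤ C) :
    Summable fun n => G.γ ^ n * u n := by
  refine Summable.of_norm_bounded
    ((summable_geometric_of_lt_one G.γ_nonneg G.γ_lt_one).mul_right C) fun n => ?_
  rw [Real.norm_eq_abs, abs_mul, abs_of_nonneg (pow_nonneg G.γ_nonneg n)]
  exact mul_le_mul_of_nonneg_left (hu n) (pow_nonneg G.γ_nonneg n)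

theorem value_eq {τ : ℕ} (o : G.Occ τ) (β₁ : Strategy A₁ Z₁) (β₂ : Strategy A₂ Z₂) :
    G.value o β₁ β₂ =
      G.reward o (β₁ τ) (β₂ τ) + G.γ * G.value (G.next o (β₁ τ) (β₂ τ)) β₁ β₂ := by
  unfold value
  rw [(G.summable_discounted fun n => G.abs_expReward_le β₁ β₂ n τ o).tsum_eq_zero_add,
    ← tsum_mul_left]
  simp only [pow_zero, one_mul, expReward, pow_succ']
  congr 1
  exact tsum_congr fun n => by ring

/-- Each expected reward is `rewardBound`-Lipschitz whatever the delay, and the geometric series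
supplies the factor `1 / (1 - γ)`. -/
theorem abs_value_sub_le {τ : ℕ} (o o' : G.Occ τ) (β₁ : Strategy A₁ Z₁) (β₂ : Strategy A₂ Z₂) :
    |G.value o β₁ β₂ - G.value o' β₁ β₂| ≤ G.rewardBound / (1 - G.γ) * G.l1 o o' := by
  unfold value
  rw [← (G.summable_discounted fun n => G.abs_expReward_le β₁ β₂ n τ o).tsum_sub
    (G.summable_discounted fun n => G.abs_expReward_le β₁ β₂ n τ o')]
  have h := ((hasSum_geometric_of_lt_one G.γ_nonneg G.γ_lt_one).mul_right
    (G.rewardBound * G.l1 o o'))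
  have := tsum_of_norm_bounded h (f := fun n => G.γ ^ n * G.expReward β₁ β₂ n τ o -
    G.γ ^ n * G.expReward β₁ β₂ n τ o') fun n => by
      rw [Real.norm_eq_abs, ← mul_sub, abs_mul, abs_of_nonneg (pow_nonneg G.γ_nonneg n)]
      exact mul_le_mul_of_nonneg_left (G.abs_expReward_sub_le β₁ β₂ n τ o o')
        (pow_nonneg G.γ_nonneg n)
  rw [Real.norm_eq_abs] at this
  refine this.trans_eq ?_
  ring

end POSG

/-! ### Realization plans -/

section Plans

variable {A Z : Type*} [Fintype A]

/-- The realization weight of a history: the probability that the strategy `β` plays its actions of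
the time steps from `τ` on, given the observations. -/
def Strategy.weight (τ : ℕ) (β : Strategy A Z) : (t : ℕ) → Hist A Z t → ℝ
  | 0, _ => 1
  | t + 1, (θ, a, _) => if τ ≤ t then Strategy.weight τ β t θ * (β t θ).1 a else 1

/-- The realization plan (sequence form) of a strategy. -/
def Strategy.plan (τ : ℕ) (β : Strategy A Z) (t : ℕ) (θ : Hist A Z t) (a : A) : ℝ :=
  Strategy.weight τ β t θ * (β t θ).1 a

namespace Strategy

theorem weight_of_le {τ t : ℕ} (β : Strategy A Z) (ht : t ≤ τ) (θ : Hist A Z t) :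
    weight τ β t θ = 1 := by
  cases t with
  | zero => rfl
  | succ t =>
    obtain ⟨θ, a, z⟩ := θ
    exact if_neg (by omega)

theorem weight_succ {τ t : ℕ} (β : Strategy A Z) (ht : τ ≤ t) (θ : Hist A Z t) (a : A) (z : Z) :
    weight τ β (t + 1) (θ, a, z) = weight τ β t θ * (β t θ).1 a :=
  if_pos ht

theorem weight_nonneg (τ : ℕ) (β : Strategy A Z) (t : ℕ) (θ : Hist A Z t) :
    0 ≤ weight τ β t θ := by
  induction t with
  | zero => exact zero_le_one
  | succ t ih =>
    rcases le_or_gt τ t with h | h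
    · obtain ⟨θ, a, z⟩ := θ
      rw [weight_succ β h]
      exact mul_nonneg (ih θ) ((β t θ).2.1 a)
    · rw [weight_of_le β (by omega)]
      exact zero_le_one

theorem continuous_rule (t : ℕ) (θ : Hist A Z t) (a : A) :
    Continuous fun β : Strategy A Z => (β t θ).1 a :=
  (continuous_apply a).comp (continuous_subtype_val.comp
    ((continuous_apply θ).comp (continuous_apply t)))

theorem continuous_weight (τ t : ℕ) (θ : Hist A Z t) :
    Continuous fun β : Strategy A Z => weight τ β t θ := by
  induction t with
  | zero => exact continuous_const
  | succ t ih =>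
    rcases le_or_gt τ t with h | h
    · obtain ⟨θ, a, z⟩ := θ
      simp only [weight_succ _ h]
      exact (ih θ).mul (continuous_rule t θ a)
    · simp only [weight_of_le _ (show t + 1 ≤ τ by omega)]
      exact continuous_const

theorem continuous_plan (τ : ℕ) : Continuous (plan τ : Strategy A Z → _) :=
  continuous_pi fun t => continuous_pi fun θ => continuous_pi fun a =>
    (continuous_weight τ t θ).mul (continuous_rule t θ a)

/-- Kuhn's argument: mixtures of realization plans are realization plans. -/
theorem exists_plan_eq_mix (τ : ℕ) (β β' : Strategy A Z) {c c' : ℝ} (hc : 0 ≤ c) (hc' : 0 ≤ c')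
    (h : c + c' = 1) :
    ∃ β'' : Strategy A Z, plan τ β'' = c • plan τ β + c' • plan τ β' := by
  classical
  let d : (t : ℕ) → Hist A Z t → ℝ := fun t θ => c * weight τ β t θ + c' * weight τ β' t θ
  have h1 : ∀ t θ, 0 ≤ c * weight τ β t θ := fun t θ => mul_nonneg hc (weight_nonneg _ _ _ _)
  have h2 : ∀ t θ, 0 ≤ c' * weight τ β' t θ := fun t θ => mul_nonneg hc' (weight_nonneg _ _ _ _)
  -- The posterior average of the two rules: each is weighted by the conditional probability, given
  -- the history, that it was the strategy drawn.
  let f : (t : ℕ) → Hist A Z t → A → ℝ := fun t θ a =>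
    c * weight τ β t θ / d t θ * (β t θ).1 a + c' * weight τ β' t θ / d t θ * (β' t θ).1 a
  have hf : ∀ t θ, d t θ ≠ 0 → f t θ ∈ stdSimplex ℝ A := by
    intro t θ hd
    have hd0 : 0 ≤ d t θ := add_nonneg (h1 t θ) (h2 t θ)
    refine ⟨fun a => add_nonneg (mul_nonneg (div_nonneg (h1 t θ) hd0) ((β t θ).2.1 a))
      (mul_nonneg (div_nonneg (h2 t θ) hd0) ((β' t θ).2.1 a)), ?_⟩
    simp only [f, Finset.sum_add_distrib, ← Finset.mul_sum]
    rw [(β t θ).2.2, (β' t θ).2.2, mul_one, mul_one, ← add_div]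
    exact div_self hd
  -- The default on histories of weight zero is immaterial: both plan terms vanish there.
  let β'' : Strategy A Z := fun t θ => if hd : d t θ = 0 then β t θ else ⟨f t θ, hf t θ hd⟩
  have hβ : ∀ t θ a, d t θ * (β'' t θ).1 a = c * plan τ β t θ a + c' * plan τ β' t θ a := by
    intro t θ a
    simp only [plan]
    by_cases hd : d t θ = 0
    · have e1 : c * weight τ β t θ = 0 := by
        have := h1 t θ; have := h2 t θ; have hd' := hd; simp only [d] at hd'; linarith
      have e2 : c' * weight τ β' t θ = 0 := by simp only [d] at hd; linarith
      rw [hd, ← mul_assoc, ← mul_assoc, e1, e2]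
      ring
    · simp only [β'', dif_neg hd, f]
      field_simp
  have hw : ∀ t θ, weight τ β'' t θ = d t θ := by
    intro t
    induction t with
    | zero => intro θ; simp only [d, weight, mul_one, h]
    | succ t ih =>
      intro θ
      rcases le_or_gt τ t with ht | ht
      · obtain ⟨θ, a, z⟩ := θ
        simp only [d]
        rw [weight_succ _ ht, weight_succ _ ht, weight_succ _ ht, ih]
        exact hβ t θ a
      · simp only [d, weight_of_le _ (show t + 1 ≤ τ by omega), mul_one, h]
  refine ⟨β'', ?_⟩
  funext t θ a
  simp only [Pi.add_apply, Pi.smul_apply, smul_eq_mul]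
  rw [← hβ, ← hw]
  rfl

theorem convex_range_plan (τ : ℕ) : Convex ℝ (Set.range (plan τ : Strategy A Z → _)) := by
  rintro _ ⟨β, rfl⟩ _ ⟨β', rfl⟩ c c' hc hc' h
  exact exists_plan_eq_mix τ β β' hc hc' h

theorem isCompact_range_plan (τ : ℕ) : IsCompact (Set.range (plan τ : Strategy A Z → _)) :=
  isCompact_range (continuous_plan τ)

end Strategy

end Plans

instance stdSimplex.nonempty_coe {A : Type*} [Fintype A] [Nonempty A] :
    Nonempty (stdSimplex ℝ A) := by
  classical
  exact ⟨⟨_, single_mem_stdSimplex ℝ (Classical.arbitrary A)⟩⟩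

namespace POSG

variable {S A₁ A₂ Z₁ Z₂ : Type*} [Fintype S] [Fintype A₁] [Fintype A₂] [Fintype Z₁] [Fintype Z₂]
variable (G : POSG S A₁ A₂ Z₁ Z₂)

/-! ### Existence of Nash equilibria -/

/-- The expected reward after `n` steps as a bilinear function of realization plans. -/
def planReward (X : (t : ℕ) → Hist A₁ Z₁ t → A₁ → ℝ) (Y : (t : ℕ) → Hist A₂ Z₂ t → A₂ → ℝ) :
    ℕ → (t : ℕ) → (S × Hist A₁ Z₁ t × Hist A₂ Z₂ t → ℝ) → ℝ
  | 0, t, m => ∑ x, m x * ∑ a₁, ∑ a₂, X t x.2.1 a₁ * Y t x.2.2 a₂ * G.r x.1 a₁ a₂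
  | n + 1, t, m => planReward X Y n (t + 1) (G.step m)

theorem planReward_mix_left (X X' : (t : ℕ) → Hist A₁ Z₁ t → A₁ → ℝ)
    (Y : (t : ℕ) → Hist A₂ Z₂ t → A₂ → ℝ) (c c' : ℝ) (n t : ℕ)
    (m : S × Hist A₁ Z₁ t × Hist A₂ Z₂ t → ℝ) :
    G.planReward (c • X + c' • X') Y n t m =
      c * G.planReward X Y n t m + c' * G.planReward X' Y n t m := by
  induction n generalizing t with
  | zero =>
    simp only [planReward, Pi.add_apply, Pi.smul_apply, smul_eq_mul, Finset.mul_sum,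
      ← Finset.sum_add_distrib]
    refine Finset.sum_congr rfl fun x _ => Finset.sum_congr rfl fun a₁ _ =>
      Finset.sum_congr rfl fun a₂ _ => ?_
    ring
  | succ n ih => exact ih _ _

theorem planReward_mix_right (X : (t : ℕ) → Hist A₁ Z₁ t → A₁ → ℝ)
    (Y Y' : (t : ℕ) → Hist A₂ Z₂ t → A₂ → ℝ) (c c' : ℝ) (n t : ℕ)
    (m : S × Hist A₁ Z₁ t × Hist A₂ Z₂ t → ℝ) :
    G.planReward X (c • Y + c' • Y') n t m =
      c * G.planReward X Y n t m + c' * G.planReward X Y' n t m := by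
  induction n generalizing t with
  | zero =>
    simp only [planReward, Pi.add_apply, Pi.smul_apply, smul_eq_mul, Finset.mul_sum,
      ← Finset.sum_add_distrib]
    refine Finset.sum_congr rfl fun x _ => Finset.sum_congr rfl fun a₁ _ =>
      Finset.sum_congr rfl fun a₂ _ => ?_
    ring
  | succ n ih => exact ih _ _

theorem continuous_planReward (n t : ℕ) (m : S × Hist A₁ Z₁ t × Hist A₂ Z₂ t → ℝ) :
    Continuous fun p : ((t : ℕ) → Hist A₁ Z₁ t → A₁ → ℝ) × ((t : ℕ) → Hist A₂ Z₂ t → A₂ → ℝ) =>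
      G.planReward p.1 p.2 n t m := by
  induction n generalizing t with
  | zero =>
    simp only [planReward]
    fun_prop
  | succ n ih => exact ih _ _

/-- The factorization `h` of the occupancy state into the two realization weights and a
strategy-free mass is preserved by a transition, which multiplies the weights by action
probabilities and applies `step` to the mass. -/
theorem expReward_eq_planReward (β₁ : Strategy A₁ Z₁) (β₂ : Strategy A₂ Z₂) (τ n t : ℕ)
    (ht : τ ≤ t) (o : G.Occ t) (m : S × Hist A₁ Z₁ t × Hist A₂ Z₂ t → ℝ)
    (h : ∀ s θ₁ θ₂, o.1 (s, θ₁, θ₂) =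
      Strategy.weight τ β₁ t θ₁ * Strategy.weight τ β₂ t θ₂ * m (s, θ₁, θ₂)) :
    G.expReward β₁ β₂ n t o =
      G.planReward (Strategy.plan τ β₁) (Strategy.plan τ β₂) n t m := by
  induction n generalizing t with
  | zero =>
    simp only [expReward, reward_eq_sum, planReward, condReward, Strategy.plan, Finset.mul_sum]
    refine Finset.sum_congr rfl fun x _ => Finset.sum_congr rfl fun a₁ _ =>
      Finset.sum_congr rfl fun a₂ _ => ?_
    rw [h x.1 x.2.1 x.2.2]
    ring
  | succ n ih =>
    refine ih (t + 1) (by omega) _ _ ?_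
    rintro s ⟨θ₁, a₁, z₁⟩ ⟨θ₂, a₂, z₂⟩
    rw [Strategy.weight_succ _ ht, Strategy.weight_succ _ ht]
    change (β₁ t θ₁).1 a₁ * (β₂ t θ₂).1 a₂ * (∑ s', _ * o.1 (s', θ₁, θ₂)) =
      _ * (∑ s', (G.P s' a₁ a₂).1 (s, z₁, z₂) * m (s', θ₁, θ₂))
    simp only [h, Finset.mul_sum]
    exact Finset.sum_congr rfl fun s' _ => by ring

/-- The value of a pair of realization plans. -/
noncomputable def planValue {τ : ℕ} (o : G.Occ τ) (Y : (t : ℕ) → Hist A₂ Z₂ t → A₂ → ℝ)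
    (X : (t : ℕ) → Hist A₁ Z₁ t → A₁ → ℝ) : ℝ :=
  ∑' n : ℕ, G.γ ^ n * G.planReward X Y n τ o.1

theorem planReward_plan {τ : ℕ} (o : G.Occ τ) (β₁ : Strategy A₁ Z₁) (β₂ : Strategy A₂ Z₂) (n : ℕ) :
    G.planReward (Strategy.plan τ β₁) (Strategy.plan τ β₂) n τ o.1 = G.expReward β₁ β₂ n τ o :=
  (G.expReward_eq_planReward β₁ β₂ τ n τ le_rfl o o.1 fun s θ₁ θ₂ => by
    rw [Strategy.weight_of_le _ le_rfl, Strategy.weight_of_le _ le_rfl, one_mul, one_mul]).symm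

theorem abs_planReward_le {τ : ℕ} (o : G.Occ τ) {X : (t : ℕ) → Hist A₁ Z₁ t → A₁ → ℝ}
    {Y : (t : ℕ) → Hist A₂ Z₂ t → A₂ → ℝ} (hX : X ∈ Set.range (Strategy.plan τ))
    (hY : Y ∈ Set.range (Strategy.plan τ)) (n : ℕ) :
    |G.planReward X Y n τ o.1| ≤ G.rewardBound := by
  obtain ⟨β₁, rfl⟩ := hX
  obtain ⟨β₂, rfl⟩ := hY
  rw [planReward_plan]
  exact G.abs_expReward_le _ _ _ _ _

theorem planValue_plan {τ : ℕ} (o : G.Occ τ) (β₁ : Strategy A₁ Z₁) (β₂ : Strategy A₂ Z₂) :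
    G.planValue o (Strategy.plan τ β₂) (Strategy.plan τ β₁) = G.value o β₁ β₂ :=
  tsum_congr fun n => by rw [planReward_plan]

/-- Weierstrass M-test. The uniform bound on the terms comes from actual strategies, hence the
restriction to realization plans. -/
theorem continuousOn_planValue {τ : ℕ} (o : G.Occ τ) :
    ContinuousOn (fun p : ((t : ℕ) → Hist A₁ Z₁ t → A₁ → ℝ) × ((t : ℕ) → Hist A₂ Z₂ t → A₂ → ℝ) =>
      G.planValue o p.2 p.1) (Set.range (Strategy.plan τ) ×ˢ Set.range (Strategy.plan τ)) := by
  refine continuousOn_tsum (u := fun n => G.γ ^ n * G.rewardBound)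
    (fun n => (continuous_const.mul (G.continuous_planReward n τ o.1)).continuousOn)
    ((summable_geometric_of_lt_one G.γ_nonneg G.γ_lt_one).mul_right _) ?_
  intro n p hp
  rw [Real.norm_eq_abs, abs_mul, abs_of_nonneg (pow_nonneg G.γ_nonneg n)]
  exact mul_le_mul_of_nonneg_left (G.abs_planReward_le o hp.1 hp.2 n) (pow_nonneg G.γ_nonneg n)

theorem exists_isNash [Nonempty A₁] [Nonempty A₂] {τ : ℕ} (o : G.Occ τ) :
    ∃ β₁ β₂, G.IsNash o β₁ β₂ := by
  have hsum : ∀ {X : (t : ℕ) → Hist A₁ Z₁ t → A₁ → ℝ} {Y : (t : ℕ) → Hist A₂ Z₂ t → A₂ → ℝ},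
      X ∈ Set.range (Strategy.plan τ) → Y ∈ Set.range (Strategy.plan τ) →
      Summable fun n => G.γ ^ n * G.planReward X Y n τ o.1 :=
    fun hX hY => G.summable_discounted (G.abs_planReward_le o hX hY)
  -- The first variable of Sion's theorem is the minimizing one, so player 2 comes first.
  obtain ⟨_, ⟨β₂, rfl⟩, _, ⟨β₁, rfl⟩, h⟩ := Sion.exists_isSaddlePointOn
    (X := Set.range (Strategy.plan τ : Strategy A₂ Z₂ → _))
    (Y := Set.range (Strategy.plan τ : Strategy A₁ Z₁ → _)) (f := G.planValue o)
    (Set.range_nonempty _) (Strategy.convex_range_plan τ) (Strategy.isCompact_range_plan τ)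
    (fun X hX => ContinuousOn.lowerSemicontinuousOn
      ((G.continuousOn_planValue o).comp (f := fun Y => (X, Y)) (by fun_prop)
        fun Y hY => ⟨hX, hY⟩))
    (fun X hX => ConvexOn.quasiconvexOn ⟨Strategy.convex_range_plan τ, fun Y hY Y' hY' c c' _ _ _ =>
      le_of_eq (by
        simp only [planValue, planReward_mix_right, smul_eq_mul]
        rw [← tsum_mul_left, ← tsum_mul_left, ← ((hsum hX hY).mul_left c).tsum_add
          ((hsum hX hY').mul_left c')]
        exact tsum_congr fun n => by ring)⟩)
    (Strategy.convex_range_plan τ) (Set.range_nonempty _) (Strategy.isCompact_range_plan τ)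
    (fun Y hY => ContinuousOn.upperSemicontinuousOn
      ((G.continuousOn_planValue o).comp (f := fun X => (X, Y)) (by fun_prop)
        fun X hX => ⟨hX, hY⟩))
    (fun Y hY => ConcaveOn.quasiconcaveOn ⟨Strategy.convex_range_plan τ,
      fun X hX X' hX' c c' _ _ _ => le_of_eq (by
        simp only [planValue, planReward_mix_left, smul_eq_mul]
        rw [← tsum_mul_left, ← tsum_mul_left, ← ((hsum hX hY).mul_left c).tsum_add
          ((hsum hX' hY).mul_left c')]
        exact tsum_congr fun n => by ring)⟩)
  have h' : ∀ β₁' β₂', G.value o β₁' β₂ ≤ G.value o β₁ β₂' := fun β₁' β₂' => by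
    simpa only [planValue_plan] using h _ ⟨β₂', rfl⟩ _ ⟨β₁', rfl⟩
  exact ⟨β₁, β₂, fun β₁' => h' β₁' β₂, fun β₂' => h' β₁ β₂'⟩

/-! ### The optimal value -/

variable [Nonempty A₁] [Nonempty A₂]

theorem exists_isNash_value_eq_optValue {τ : ℕ} (o : G.Occ τ) :
    ∃ β₁ β₂, G.IsNash o β₁ β₂ ∧ G.value o β₁ β₂ = G.optValue o := by
  obtain ⟨β₁, β₂, h⟩ := G.exists_isNash o
  exact Classical.epsilon_spec (p := fun v => ∃ β₁ β₂, G.IsNash o β₁ β₂ ∧ G.value o β₁ β₂ = v)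
    ⟨_, β₁, β₂, h, rfl⟩

/-- Optimal strategies of the subgame at `o` guarantee the optimal value. -/
theorem exists_optimal {τ : ℕ} (o : G.Occ τ) : ∃ β₁ β₂,
    (∀ β₂', G.optValue o ≤ G.value o β₁ β₂') ∧ ∀ β₁', G.value o β₁' β₂ ≤ G.optValue o := by
  obtain ⟨β₁, β₂, h, hv⟩ := G.exists_isNash_value_eq_optValue o
  exact ⟨β₁, β₂, fun β₂' => hv ▸ h.2 β₂', fun β₁' => hv ▸ h.1 β₁'⟩

/-- Pair a strategy of player 1 optimal at `o` with one of player 2 optimal at `o'`: the value of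
this profile is at least `optValue o` at `o` and at most `optValue o'` at `o'`. -/
theorem isLipschitzConst {lam : ℝ} (h : G.rewardBound / (1 - G.γ) ≤ lam) :
    G.IsLipschitzConst lam := by
  have key : ∀ (τ : ℕ) (o o' : G.Occ τ), G.optValue o - G.optValue o' ≤ lam * G.l1 o o' := by
    intro τ o o'
    obtain ⟨β₁, -, h₁, -⟩ := G.exists_optimal o
    obtain ⟨-, β₂, -, h₂⟩ := G.exists_optimal o'
    have h3 := (le_abs_self _).trans (G.abs_value_sub_le o o' β₁ β₂)
    have h4 := mul_le_mul_of_nonneg_right h (G.l1_nonneg o o')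
    linarith [h₁ β₂, h₂ β₁]
  intro τ o o'
  rw [abs_sub_le_iff]
  exact ⟨key τ o o', G.l1_comm o o' ▸ key τ o' o⟩

/-- In the local game with the optimal continuation values, player 1 can guarantee `V*`. -/
theorem exists_optValue_le_localGame {τ : ℕ} (o : G.Occ τ) : ∃ β₁ : DecisionRule A₁ Z₁ τ,
    ∀ β₂, G.optValue o ≤ G.localGame (fun _ o' => G.optValue o') o β₁ β₂ := by
  obtain ⟨β₁, -, h₁, -⟩ := G.exists_optimal o
  refine ⟨β₁ τ, fun b₂ => ?_⟩
  obtain ⟨-, β₂, -, h₂⟩ := G.exists_optimal (G.next o (β₁ τ) b₂)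
  -- The opponent plays `b₂` now and an optimal strategy of the resulting subgame afterwards; the
  -- tail does not see the change at time `τ`.
  have h3 := h₁ (Function.update β₂ τ b₂)
  rw [value_eq, Function.update_self, G.value_congr (β₁' := β₁) (β₂' := β₂) _ (fun _ _ => rfl)
    fun t ht => Function.update_of_ne (by omega) _ _] at h3
  exact h3.trans (add_le_add_right (mul_le_mul_of_nonneg_left (h₂ β₁) G.γ_nonneg) _)

theorem exists_localGame_le_optValue {τ : ℕ} (o : G.Occ τ) : ∃ β₂ : DecisionRule A₂ Z₂ τ,
    ∀ β₁, G.localGame (fun _ o' => G.optValue o') o β₁ β₂ ≤ G.optValue o := by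
  obtain ⟨-, β₂, -, h₂⟩ := G.exists_optimal o
  refine ⟨β₂ τ, fun b₁ => ?_⟩
  obtain ⟨β₁, -, h₁, -⟩ := G.exists_optimal (G.next o b₁ (β₂ τ))
  have h3 := h₂ (Function.update β₁ τ b₁)
  rw [value_eq, Function.update_self, G.value_congr (β₁' := β₁) (β₂' := β₂) _
    (fun t ht => Function.update_of_ne (by omega) _ _) fun _ _ => rfl] at h3
  exact (add_le_add_right (mul_le_mul_of_nonneg_left (h₁ β₂) G.γ_nonneg) _).trans h3

end POSG

namespace POSG

variable {S A₁ A₂ Z₁ Z₂ : Type*} [Fintype S] [Fintype A₁] [Fintype A₂] [Fintype Z₁] [Fintype Z₂]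
variable (G : POSG S A₁ A₂ Z₁ Z₂)

/-! ### Local games -/

/-- All functions `V τ` are `lam`-Lipschitz in `1`-norm. -/
def IsLip (lam : ℝ) (V : G.ValueFn) : Prop :=
  ∀ (τ : ℕ) (o o' : G.Occ τ), |V τ o - V τ o'| ≤ lam * G.l1 o o'

variable {G} in
theorem IsLip.continuous {lam : ℝ} {V : G.ValueFn} (hV : G.IsLip lam V) (τ : ℕ) :
    Continuous (V τ) := by
  refine continuous_iff_continuousAt.2 fun o => tendsto_iff_dist_tendsto_zero.2 ?_
  have h : Filter.Tendsto (fun o' => lam * G.l1 o o') (nhds o) (nhds 0) := by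
    have := ((G.continuous_l1 o).const_mul lam).tendsto o
    rwa [l1_self, mul_zero] at this
  refine squeeze_zero (fun _ => dist_nonneg) (fun o' => ?_) h
  rw [Real.dist_eq, l1_comm]
  exact hV τ o' o

theorem continuous_decisionRule_apply {A Z : Type*} [Fintype A] {τ : ℕ} (θ : Hist A Z τ) (a : A) :
    Continuous fun β : DecisionRule A Z τ => (β θ).1 a :=
  (continuous_apply a).comp (continuous_subtype_val.comp (continuous_apply θ))

theorem continuous_next {τ : ℕ} (o : G.Occ τ) :
    Continuous fun p : DecisionRule A₁ Z₁ τ × DecisionRule A₂ Z₂ τ => G.next o p.1 p.2 := by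
  refine Continuous.subtype_mk (continuous_pi fun x => ?_) _
  obtain ⟨s, ⟨θ₁, a₁, z₁⟩, ⟨θ₂, a₂, z₂⟩⟩ := x
  exact (((continuous_decisionRule_apply θ₁ a₁).comp continuous_fst).mul
    ((continuous_decisionRule_apply θ₂ a₂).comp continuous_snd)).mul continuous_const

theorem continuous_reward {τ : ℕ} (o : G.Occ τ) :
    Continuous fun p : DecisionRule A₁ Z₁ τ × DecisionRule A₂ Z₂ τ => G.reward o p.1 p.2 := by
  refine continuous_finsetSum _ fun s _ => continuous_finsetSum _ fun θ₁ _ =>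
    continuous_finsetSum _ fun θ₂ _ => continuous_const.mul (continuous_finsetSum _ fun a₁ _ =>
      continuous_finsetSum _ fun a₂ _ => ?_)
  exact (((continuous_decisionRule_apply θ₁ a₁).comp continuous_fst).mul
    ((continuous_decisionRule_apply θ₂ a₂).comp continuous_snd)).mul continuous_const

variable {G} in
theorem IsLip.continuous_localGame {lam : ℝ} {V : G.ValueFn} (hV : G.IsLip lam V) {τ : ℕ}
    (o : G.Occ τ) : Continuous fun p : DecisionRule A₁ Z₁ τ × DecisionRule A₂ Z₂ τ =>
      G.localGame V o p.1 p.2 :=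
  (G.continuous_reward o).add
    (continuous_const.mul ((hV.continuous (τ + 1)).comp (G.continuous_next o)))

theorem continuous_iInf_of_compactSpace {X Y : Type*} [TopologicalSpace X] [TopologicalSpace Y]
    [CompactSpace Y] {f : X → Y → ℝ} (hf : Continuous fun p : X × Y => f p.1 p.2) :
    Continuous fun x => ⨅ y, f x y := by
  simpa only [Set.image_univ, sInf_range] using
    isCompact_univ.continuous_sInf (K := (Set.univ : Set Y)) (f := f) hf

theorem continuous_iSup_of_compactSpace {X Y : Type*} [TopologicalSpace X] [TopologicalSpace Y]
    [CompactSpace Y] {f : X → Y → ℝ} (hf : Continuous fun p : X × Y => f p.1 p.2) :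
    Continuous fun x => ⨆ y, f x y := by
  simpa only [Set.image_univ, sSup_range] using
    isCompact_univ.continuous_sSup (K := (Set.univ : Set Y)) (f := f) hf

section

variable {G} {lam : ℝ} {V : G.ValueFn} {τ : ℕ}

theorem IsLip.continuous_iInf_localGame (hV : G.IsLip lam V) (o : G.Occ τ) :
    Continuous fun β₁ => ⨅ β₂, G.localGame V o β₁ β₂ :=
  continuous_iInf_of_compactSpace (hV.continuous_localGame o)

theorem IsLip.continuous_iSup_localGame (hV : G.IsLip lam V) (o : G.Occ τ) :
    Continuous fun β₂ => ⨆ β₁, G.localGame V o β₁ β₂ := by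
  have h : Continuous fun p : DecisionRule A₂ Z₂ τ × DecisionRule A₁ Z₁ τ =>
      G.localGame V o p.2 p.1 :=
    (hV.continuous_localGame o).comp (f := Prod.swap) continuous_swap
  exact continuous_iSup_of_compactSpace (f := fun β₂ β₁ => G.localGame V o β₁ β₂) h

theorem IsLip.iInf_localGame_le (hV : G.IsLip lam V) (o : G.Occ τ) (β₁ : DecisionRule A₁ Z₁ τ)
    (β₂ : DecisionRule A₂ Z₂ τ) : ⨅ β₂, G.localGame V o β₁ β₂ ≤ G.localGame V o β₁ β₂ :=
  ciInf_le (isCompact_range ((hV.continuous_localGame o).comp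
    (Continuous.prodMk_right β₁))).bddBelow β₂

theorem IsLip.le_iSup_localGame (hV : G.IsLip lam V) (o : G.Occ τ) (β₁ : DecisionRule A₁ Z₁ τ)
    (β₂ : DecisionRule A₂ Z₂ τ) : G.localGame V o β₁ β₂ ≤ ⨆ β₁, G.localGame V o β₁ β₂ :=
  le_ciSup (isCompact_range ((hV.continuous_localGame o).comp
    (Continuous.prodMk_left β₂))).bddAbove β₁

theorem localGame_mono {V W : G.ValueFn} (h : ∀ (τ : ℕ) (o : G.Occ τ), V τ o ≤ W τ o)
    (o : G.Occ τ) (β₁ : DecisionRule A₁ Z₁ τ) (β₂ : DecisionRule A₂ Z₂ τ) :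
    G.localGame V o β₁ β₂ ≤ G.localGame W o β₁ β₂ :=
  add_le_add_right (mul_le_mul_of_nonneg_left (h _ _) G.γ_nonneg) _

/-- Decision rules form a compact space, being a product of simplices, and the guaranteed payoff is
continuous. This keeps the algorithm from getting stuck. -/
theorem IsLip.exists_isMaximin [Nonempty A₁] (hV : G.IsLip lam V) (o : G.Occ τ) : ∃ β₁, G.IsMaximin V o β₁ := by
  obtain ⟨β₁, -, h⟩ := isCompact_univ.exists_isMaxOn Set.univ_nonempty
    (hV.continuous_iInf_localGame o).continuousOn
  exact ⟨β₁, fun β₁' => h (Set.mem_univ β₁')⟩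

theorem IsLip.exists_isMinimax [Nonempty A₂] (hV : G.IsLip lam V) (o : G.Occ τ) : ∃ β₂, G.IsMinimax V o β₂ := by
  obtain ⟨β₂, -, h⟩ := isCompact_univ.exists_isMinOn Set.univ_nonempty
    (hV.continuous_iSup_localGame o).continuousOn
  exact ⟨β₂, fun β₂' => h (Set.mem_univ β₂')⟩

theorem IsLip.maximin_le [Nonempty A₁] (hV : G.IsLip lam V) {o : G.Occ τ} {β₁ : DecisionRule A₁ Z₁ τ}
    (h : G.IsMaximin V o β₁) (β₂ : DecisionRule A₂ Z₂ τ) :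
    G.maximin V o ≤ G.localGame V o β₁ β₂ :=
  (ciSup_le h).trans (hV.iInf_localGame_le o β₁ β₂)

theorem IsLip.le_minimax [Nonempty A₂] (hV : G.IsLip lam V) {o : G.Occ τ} {β₂ : DecisionRule A₂ Z₂ τ}
    (h : G.IsMinimax V o β₂) (β₁ : DecisionRule A₁ Z₁ τ) :
    G.localGame V o β₁ β₂ ≤ G.minimax V o :=
  (hV.le_iSup_localGame o β₁ β₂).trans (le_ciInf h)

variable [Nonempty A₁] [Nonempty A₂]

theorem IsLip.optValue_le_maximin (hV : G.IsLip lam V)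
    (h : ∀ (τ : ℕ) (o : G.Occ τ), G.optValue o ≤ V τ o) (o : G.Occ τ) :
    G.optValue o ≤ G.maximin V o := by
  obtain ⟨β₁, h₁⟩ := G.exists_optValue_le_localGame o
  exact (le_ciInf fun β₂ => (h₁ β₂).trans (localGame_mono h o β₁ β₂)).trans
    (le_ciSup (isCompact_range (hV.continuous_iInf_localGame o)).bddAbove β₁)

theorem IsLip.minimax_le_optValue (hV : G.IsLip lam V)
    (h : ∀ (τ : ℕ) (o : G.Occ τ), V τ o ≤ G.optValue o) (o : G.Occ τ) :
    G.minimax V o ≤ G.optValue o := by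
  obtain ⟨β₂, h₂⟩ := G.exists_localGame_le_optValue o
  exact (ciInf_le (isCompact_range (hV.continuous_iSup_localGame o)).bddBelow β₂).trans
    (ciSup_le fun β₁ => (localGame_mono h o β₁ β₂).trans (h₂ β₁))

end

/-! ### Point-based updates -/

theorem updateU_le (lam : ℝ) (U : G.ValueFn) {τ : ℕ} (o : G.Occ τ) (t : ℕ) (ω : G.Occ t) :
    G.updateU lam U o t ω ≤ U t ω := by
  rcases eq_or_ne t τ with rfl | h
  · rw [updateU, Function.update_self]
    exact min_le_left _ _
  · rw [updateU, Function.update_of_ne h]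

theorem le_updateL (lam : ℝ) (L : G.ValueFn) {τ : ℕ} (o : G.Occ τ) (t : ℕ) (ω : G.Occ t) :
    L t ω ≤ G.updateL lam L o t ω := by
  rcases eq_or_ne t τ with rfl | h
  · rw [updateL, Function.update_self]
    exact le_max_left _ _
  · rw [updateL, Function.update_of_ne h]

theorem updateU_self_le (lam : ℝ) (U : G.ValueFn) {τ : ℕ} (o : G.Occ τ) :
    G.updateU lam U o τ o ≤ G.maximin U o := by
  rw [updateU, Function.update_self]
  refine (min_le_right _ _).trans_eq ?_
  rw [l1_self, mul_zero, add_zero]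

theorem le_updateL_self (lam : ℝ) (L : G.ValueFn) {τ : ℕ} (o : G.Occ τ) :
    G.minimax L o ≤ G.updateL lam L o τ o := by
  rw [updateL, Function.update_self]
  refine le_trans (le_of_eq ?_) (le_max_right _ _)
  rw [l1_self, mul_zero, sub_zero]

theorem updateU_succ (lam : ℝ) (U : G.ValueFn) {τ : ℕ} (o : G.Occ τ) :
    G.updateU lam U o (τ + 1) = U (τ + 1) :=
  Function.update_of_ne (Nat.succ_ne_self τ) _ _

theorem updateL_succ (lam : ℝ) (L : G.ValueFn) {τ : ℕ} (o : G.Occ τ) :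
    G.updateL lam L o (τ + 1) = L (τ + 1) :=
  Function.update_of_ne (Nat.succ_ne_self τ) _ _

/-- The update alters depth `τ` only, while the local game reads depth `τ + 1`. So rules greedy for
the updated bound are also greedy for the old one. -/
theorem localGame_updateU (lam : ℝ) (U : G.ValueFn) {τ : ℕ} (o : G.Occ τ) :
    G.localGame (G.updateU lam U o) o = G.localGame U o := by
  funext β₁ β₂
  rw [localGame, updateU_succ, localGame]

theorem localGame_updateL (lam : ℝ) (L : G.ValueFn) {τ : ℕ} (o : G.Occ τ) :
    G.localGame (G.updateL lam L o) o = G.localGame L o := by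
  funext β₁ β₂
  rw [localGame, updateL_succ, localGame]

theorem width_update_le (lam : ℝ) (L U : G.ValueFn) {τ : ℕ} (o : G.Occ τ) (t : ℕ)
    (ω : G.Occ t) :
    G.updateU lam U o t ω - G.updateL lam L o t ω ≤ U t ω - L t ω :=
  sub_le_sub (G.updateU_le lam U o t ω) (G.le_updateL lam L o t ω)

variable {G} in
theorem IsLip.updateU {lam : ℝ} (hlam : 0 ≤ lam) {U : G.ValueFn} (hU : G.IsLip lam U) {τ : ℕ}
    (o : G.Occ τ) : G.IsLip lam (G.updateU lam U o) := by
  intro t ω ω'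
  rcases eq_or_ne t τ with rfl | h
  · simp only [POSG.updateU, Function.update_self]
    refine (abs_min_sub_min_le_max _ _ _ _).trans (max_le (hU t ω ω') ?_)
    rw [add_sub_add_left_eq_sub, ← mul_sub, abs_mul, abs_of_nonneg hlam]
    exact mul_le_mul_of_nonneg_left (G.abs_l1_sub_le o ω ω') hlam
  · simp only [POSG.updateU, Function.update_of_ne h]
    exact hU t ω ω'

variable {G} in
theorem IsLip.updateL {lam : ℝ} (hlam : 0 ≤ lam) {L : G.ValueFn} (hL : G.IsLip lam L) {τ : ℕ}
    (o : G.Occ τ) : G.IsLip lam (G.updateL lam L o) := by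
  intro t ω ω'
  rcases eq_or_ne t τ with rfl | h
  · simp only [POSG.updateL, Function.update_self]
    refine (abs_max_sub_max_le_max _ _ _ _).trans (max_le (hL t ω ω') ?_)
    rw [sub_sub_sub_cancel_left, ← mul_sub, abs_mul, abs_of_nonneg hlam, abs_sub_comm]
    rw [abs_sub_comm]
    exact mul_le_mul_of_nonneg_left (G.l1_comm ω ω' ▸ G.abs_l1_sub_le o ω' ω) hlam
  · simp only [POSG.updateL, Function.update_of_ne h]
    exact hL t ω ω'

variable {G} in
-- Both bounds contribute a slope `lam`; this is the origin of the term `2 * ρ * lam` in the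
-- thresholds.
theorem IsInit.width_le_add {lam : ℝ} {L U : G.ValueFn} (h : G.IsInit lam L U) {τ : ℕ}
    (o o' : G.Occ τ) : U τ o' - L τ o' ≤ U τ o - L τ o + 2 * lam * G.l1 o o' := by
  linarith [(abs_le.1 (h.lipU τ o o')).1, (abs_le.1 (h.lipL τ o o')).2]

variable [Nonempty A₁] [Nonempty A₂]

variable {G} in
theorem IsInit.update {lam : ℝ} (hlam : 0 ≤ lam) (hV : G.IsLipschitzConst lam) {L U : G.ValueFn}
    (h : G.IsInit lam L U) {τ : ℕ} (o : G.Occ τ) :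
    G.IsInit lam (G.updateL lam L o) (G.updateU lam U o) where
  lower t ω := by
    rcases eq_or_ne t τ with rfl | ht
    · rw [updateL, Function.update_self]
      refine max_le (h.lower t ω) ?_
      linarith [IsLip.minimax_le_optValue h.lipL h.lower o, (abs_le.1 (hV t o ω)).2]
    · rw [updateL, Function.update_of_ne ht]
      exact h.lower t ω
  upper t ω := by
    rcases eq_or_ne t τ with rfl | ht
    · rw [updateU, Function.update_self]
      refine le_min (h.upper t ω) ?_
      linarith [IsLip.optValue_le_maximin h.lipU h.upper o, (abs_le.1 (hV t o ω)).1]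
    · rw [updateU, Function.update_of_ne ht]
      exact h.upper t ω
  lipL := IsLip.updateL hlam h.lipL o
  lipU := IsLip.updateU hlam h.lipU o
  bounded := h.bounded.imp fun W hW t ω => (G.width_update_le lam L U o t ω).trans (hW t ω)

variable {G} in
/-- After an update at `o`, the width at `o` is controlled by the width at the next occupancy
state. -/
theorem IsInit.width_update_self_le {lam : ℝ} {L U : G.ValueFn} (h : G.IsInit lam L U) {τ : ℕ}
    {o : G.Occ τ} {β₁ : DecisionRule A₁ Z₁ τ} (h₁ : G.IsMaximin (G.updateU lam U o) o β₁)
    {β₂ : DecisionRule A₂ Z₂ τ} (h₂ : G.IsMinimax (G.updateL lam L o) o β₂) :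
    G.updateU lam U o τ o - G.updateL lam L o τ o ≤
      G.γ * (U (τ + 1) (G.next o β₁ β₂) - L (τ + 1) (G.next o β₁ β₂)) := by
  have h₁' : G.IsMaximin U o β₁ := by simpa only [IsMaximin, localGame_updateU] using h₁
  have h₂' : G.IsMinimax L o β₂ := by simpa only [IsMinimax, localGame_updateL] using h₂
  -- Each optimal rule is tested against the rule picked for the other player. Both local games then
  -- share the instant reward and the next occupancy state, and the rewards cancel.
  have h3 := (G.updateU_self_le lam U o).trans (IsLip.maximin_le h.lipU h₁' β₂)
  have h4 := (IsLip.le_minimax h.lipL h₂' β₁).trans (G.le_updateL_self lam L o)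
  simp only [localGame] at h3 h4
  linarith

end POSG

/-! ### Packing numbers -/

namespace Metric

open scoped NNReal ENNReal

variable {X : Type*} [PseudoEMetricSpace X]

theorem packingNumber_mono_set {r : ℝ≥0} {A B : Set X} (h : A ⊆ B) :
    packingNumber r A ≤ packingNumber r B :=
  iSup_mono fun _ => iSup_mono' fun hC => ⟨hC.trans h, le_rfl⟩

/-- An `r`-packing is no larger than a cover at scale `r / 2`, and compactness provides a finite
one. -/
theorem packingNumber_ne_top [CompactSpace X] {r : ℝ≥0} (hr : r ≠ 0) (A : Set X) :
    packingNumber r A ≠ ⊤ := by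
  obtain ⟨N, -, hN, hc⟩ := exists_finite_isCover_of_isCompact (ε := r / 2)
    (div_ne_zero hr two_ne_zero) (isCompact_univ (X := X))
  have h1 := packingNumber_two_mul_le_externalCoveringNumber (r / 2) (Set.univ : Set X)
  rw [mul_div_cancel₀ r two_ne_zero] at h1
  exact ne_top_of_le_ne_top (Set.encard_ne_top_iff.2 hN)
    ((packingNumber_mono_set A.subset_univ).trans (h1.trans hc.externalCoveringNumber_le_encard))

/-- Adjoin `x` to a maximum packing of `A`; finiteness makes the increase strict. -/
theorem packingNumber_lt_of_separated [CompactSpace X] {r : ℝ≥0} (hr : r ≠ 0) {A B : Set X}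
    (h : A ⊆ B) {x : X} (hx : x ∈ B) (hsep : ∀ y ∈ A, r < edist x y) :
    packingNumber r A < packingNumber r B := by
  obtain ⟨C, hC, hfin, hCs, hcard⟩ :=
    exists_set_encard_eq_packingNumber (packingNumber_ne_top hr A)
  have hxC : x ∉ C := fun hxC => by simpa using hsep x (hC hxC)
  have h1 : (insert x C).encard ≤ packingNumber r B :=
    IsSeparated.encard_le_packingNumber (Set.insert_subset hx (hC.trans h))
      ((isSeparated_insert_of_notMem hxC).2 ⟨hCs, fun y hy => hsep y (hC hy)⟩)
  rw [Set.encard_insert_of_notMem hxC, hcard] at h1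
  exact (ENat.add_one_le_iff (packingNumber_ne_top hr A)).1 h1

end Metric

namespace POSG

variable {S A₁ A₂ Z₁ Z₂ : Type*} [Fintype S] [Fintype A₁] [Fintype A₂] [Fintype Z₁] [Fintype Z₂]
variable (G : POSG S A₁ A₂ Z₁ Z₂)

/-! ### The thresholds -/

theorem thr_zero (ε lam ρ : ℝ) : G.thr ε lam ρ 0 = ε := by simp [thr]

theorem gamma_mul_thr_succ (hγ : 0 < G.γ) (ε lam ρ : ℝ) (τ : ℕ) :
    G.γ * G.thr ε lam ρ (τ + 1) = G.thr ε lam ρ τ - 2 * ρ * lam := by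
  induction τ with
  | zero => simp only [thr]; simp; field_simp
  | succ τ ih =>
    have h : ∀ t, G.thr ε lam ρ (t + 1) - G.thr ε lam ρ t =
        ((G.γ ^ (t + 1))⁻¹ - (G.γ ^ t)⁻¹) * ε - 2 * ρ * lam * (G.γ ^ (t + 1))⁻¹ := by
      intro t
      simp only [thr, Finset.sum_Icc_succ_top (Nat.le_add_left 1 t)]
      ring
    have h1 := h τ
    have h2 : G.γ * (G.thr ε lam ρ (τ + 1 + 1) - G.thr ε lam ρ (τ + 1)) =
        ((G.γ ^ (τ + 1))⁻¹ - (G.γ ^ τ)⁻¹) * ε - 2 * ρ * lam * (G.γ ^ (τ + 1))⁻¹ := by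
      rw [h (τ + 1)]
      have := hγ.ne'
      field_simp
      ring
    linarith

/-- The constant `2 * ρ * lam / (1 - γ)` is the fixed point of the recursion; the deviation from it
is multiplied by `γ⁻¹` at each depth. -/
theorem thr_eq (hγ : 0 < G.γ) (ε lam ρ : ℝ) (τ : ℕ) :
    G.thr ε lam ρ τ =
      (G.γ ^ τ)⁻¹ * (ε - 2 * ρ * lam / (1 - G.γ)) + 2 * ρ * lam / (1 - G.γ) := by
  induction τ with
  | zero => rw [thr_zero]; simp
  | succ τ ih =>
    have h := G.gamma_mul_thr_succ hγ ε lam ρ τ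
    have h0 := hγ.ne'
    have h1 : 1 - G.γ ≠ 0 := sub_ne_zero.2 G.γ_lt_one.ne'
    refine mul_left_cancel₀ h0 (h.trans ?_)
    rw [ih, pow_succ]
    field_simp
    ring

theorem exists_forall_le_thr (hγ : 0 < G.γ) {ε lam ρ : ℝ} (hlam : 0 < lam) (hρ : 0 < ρ)
    (h : ρ < (1 - G.γ) / (2 * lam) * ε) (W : ℝ) : ∃ T, ∀ τ, T ≤ τ → W ≤ G.thr ε lam ρ τ := by
  have h1 : 0 < 1 - G.γ := sub_pos.2 G.γ_lt_one
  -- The upper bound on `ρ` says precisely that the initial deviation from the fixed point is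
  -- positive, so that the thresholds diverge.
  have hc : 0 < ε - 2 * ρ * lam / (1 - G.γ) := by
    rw [sub_pos, div_lt_iff₀ h1]
    rw [div_mul_eq_mul_div, lt_div_iff₀ (by positivity)] at h
    linarith
  have hc0 : 0 ≤ 2 * ρ * lam / (1 - G.γ) := by positivity
  obtain ⟨T, hT⟩ := exists_pow_lt_of_lt_one (div_pos hc (show 0 < |W| + 1 by positivity))
    G.γ_lt_one
  refine ⟨T, fun τ hτ => ?_⟩
  have h2 := (pow_le_pow_of_le_one hγ.le G.γ_lt_one.le hτ).trans_lt hT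
  rw [lt_div_iff₀ (by positivity)] at h2
  have h3 : |W| + 1 ≤ (G.γ ^ τ)⁻¹ * (ε - 2 * ρ * lam / (1 - G.γ)) := by
    rw [inv_mul_eq_div, le_div_iff₀ (pow_pos hγ τ), mul_comm]
    exact h2.le
  rw [thr_eq G hγ]
  linarith [le_abs_self W]

/-! ### Termination -/

section Termination

variable (ε lam ρ : ℝ)

/-- The occupancy states of depth `τ` whose width exceeds the threshold. -/
def wide (L U : G.ValueFn) (τ : ℕ) : Set (G.Occ τ) :=
  {o | G.thr ε lam ρ τ < U τ o - L τ o}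

/-- A radius of balls in the sup-metric contained in the balls of radius `ρ` in the `1`-norm. -/
noncomputable def packingRadius (_G : POSG S A₁ A₂ Z₁ Z₂) (ρ : ℝ) (τ : ℕ) : NNReal :=
  Real.toNNReal (ρ / (Fintype.card (S × Hist A₁ Z₁ τ × Hist A₂ Z₂ τ) + 1))

/-- The potential of a pair of bounds: the number of separated occupancy states of depth less than
`T` at which the width may still exceed the threshold. -/
noncomputable def potential (T : ℕ) (L U : G.ValueFn) : ℕ :=
  ∑ τ ∈ Finset.range T,
    (Metric.packingNumber (G.packingRadius ρ τ) (G.wide ε lam ρ L U τ)).toNat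

variable {ε lam ρ} {G}

theorem packingRadius_ne_zero (hρ : 0 < ρ) (τ : ℕ) : G.packingRadius ρ τ ≠ 0 := by
  refine (Real.toNNReal_pos.2 ?_).ne'
  positivity

theorem lt_edist_of_lt_l1 (hρ : 0 < ρ) {τ : ℕ} {o o' : G.Occ τ} (h : ρ < G.l1 o o') :
    G.packingRadius ρ τ < edist o o' := by
  rw [edist_dist, packingRadius, ← ENNReal.ofReal, ENNReal.ofReal_lt_ofReal_iff_of_nonneg
    (by positivity), div_lt_iff₀ (by positivity)]
  refine (h.trans_le (G.l1_le_dist o o')).trans_le ?_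
  rw [mul_comm]
  exact mul_le_mul_of_nonneg_left (by linarith) dist_nonneg

theorem wide_subset {L L' U U' : G.ValueFn}
    (h : ∀ (τ : ℕ) (o : G.Occ τ), U' τ o - L' τ o ≤ U τ o - L τ o) (τ : ℕ) :
    G.wide ε lam ρ L' U' τ ⊆ G.wide ε lam ρ L U τ :=
  fun o ho => lt_of_lt_of_le ho (h τ o)

theorem toNat_packingNumber_le (hρ : 0 < ρ) {L L' U U' : G.ValueFn}
    (h : ∀ (τ : ℕ) (o : G.Occ τ), U' τ o - L' τ o ≤ U τ o - L τ o) (τ : ℕ) :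
    (Metric.packingNumber (G.packingRadius ρ τ) (G.wide ε lam ρ L' U' τ)).toNat ≤
      (Metric.packingNumber (G.packingRadius ρ τ) (G.wide ε lam ρ L U τ)).toNat :=
  ENat.toNat_le_toNat (Metric.packingNumber_mono_set (wide_subset h τ))
    (Metric.packingNumber_ne_top (packingRadius_ne_zero hρ τ) _)

theorem potential_le (hρ : 0 < ρ) (T : ℕ) {L L' U U' : G.ValueFn}
    (h : ∀ (τ : ℕ) (o : G.Occ τ), U' τ o - L' τ o ≤ U τ o - L τ o) :
    G.potential ε lam ρ T L' U' ≤ G.potential ε lam ρ T L U :=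
  Finset.sum_le_sum fun τ _ => toNat_packingNumber_le hρ h τ

/-- A point `y` still above the threshold satisfies `thr < width y ≤ thr - 2 * ρ * lam + 2 * lam *
l1 o y`, hence lies farther than `ρ` from `o`. So `o`, which was above the threshold before, can be
added to any packing of the remaining points. -/
theorem potential_lt (hρ : 0 < ρ) (hlam : 0 < lam) {T : ℕ} {L L' U U' : G.ValueFn}
    (h : ∀ (τ : ℕ) (o : G.Occ τ), U' τ o - L' τ o ≤ U τ o - L τ o) (h' : G.IsInit lam L' U')
    {τ : ℕ} (hτ : τ < T) {o : G.Occ τ} (ho : G.thr ε lam ρ τ < U τ o - L τ o)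
    (ho' : U' τ o - L' τ o ≤ G.thr ε lam ρ τ - 2 * ρ * lam) :
    G.potential ε lam ρ T L' U' < G.potential ε lam ρ T L U := by
  refine Finset.sum_lt_sum (fun τ _ => toNat_packingNumber_le hρ h τ)
    ⟨τ, Finset.mem_range.2 hτ, ?_⟩
  have hr := packingRadius_ne_zero (G := G) hρ τ
  rw [← ENat.natCast_lt_natCast, ENat.natCast_toNat (Metric.packingNumber_ne_top hr _),
    ENat.natCast_toNat (Metric.packingNumber_ne_top hr _)]
  refine Metric.packingNumber_lt_of_separated hr (wide_subset h τ) (x := o) ho fun y hy => ?_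
  refine lt_edist_of_lt_l1 hρ ?_
  have h1 : G.thr ε lam ρ τ < U' τ y - L' τ y := hy
  have h2 := h'.width_le_add o y
  have h3 : lam * ρ < lam * G.l1 o y := by linarith
  exact lt_of_mul_lt_mul_left h3 hlam.le

variable [Nonempty A₁] [Nonempty A₂]

/-- The invariant of the algorithm: the bounds are admissible, and their width is below the
threshold from depth `T` on. -/
def Invariant (ε lam ρ : ℝ) (T : ℕ) (L U : G.ValueFn) : Prop :=
  G.IsInit lam L U ∧ ∀ τ, T ≤ τ → ∀ o : G.Occ τ, U τ o - L τ o ≤ G.thr ε lam ρ τ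

theorem Invariant.update (hlam : 0 < lam) (hV : G.IsLipschitzConst lam) {T : ℕ} {L U : G.ValueFn}
    (h : Invariant ε lam ρ T L U) {τ : ℕ} (o : G.Occ τ) :
    Invariant ε lam ρ T (G.updateL lam L o) (G.updateU lam U o) :=
  ⟨h.1.update hlam.le hV o, fun t ht ω => (G.width_update_le lam L U o t ω).trans (h.2 t ht ω)⟩

/-- On the way back updates never raise the potential, so a drop below `N` survives until the next
loop test. -/
theorem acc_back (hlam : 0 < lam) (hV : G.IsLipschitzConst lam) (hρ : 0 < ρ) {T N : ℕ}
    (ih : ∀ L U, Invariant ε lam ρ T L U → G.potential ε lam ρ T L U < N →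
      Acc (fun c c' => G.Step ε lam ρ c' c) (.loop L U)) (stack : List (Σ t, G.Occ t)) :
    ∀ L U, Invariant ε lam ρ T L U → G.potential ε lam ρ T L U < N →
      Acc (fun c c' => G.Step ε lam ρ c' c) (.back L U stack) := by
  induction stack with
  | nil =>
    refine fun L U h hN => ⟨_, fun c hc => ?_⟩
    cases hc with
    | endTrial => exact ih L U h hN
  | cons x stack ihs =>
    refine fun L U h hN => ⟨_, fun c hc => ?_⟩
    cases hc with
    | backUpdate _ _ τ o _ =>
      exact ihs _ _ (h.update hlam hV o)
        ((potential_le hρ T (G.width_update_le lam L U o)).trans_lt hN)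

/-- Here `k` bounds the number of depths left before `T`. The last hypothesis records that, should
the trial be cut off at `o`, the update made at its predecessor has already lowered the potential.
-/
theorem acc_explore (hγ : 0 < G.γ) (hlam : 0 < lam) (hV : G.IsLipschitzConst lam) (hρ : 0 < ρ)
    {T N : ℕ}
    (ih : ∀ L U, Invariant ε lam ρ T L U → G.potential ε lam ρ T L U < N →
      Acc (fun c c' => G.Step ε lam ρ c' c) (.loop L U)) (k : ℕ) :
    ∀ (L U : G.ValueFn) (τ : ℕ) (o : G.Occ τ) (stack : List (Σ t, G.Occ t)), T ≤ τ + k →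
      Invariant ε lam ρ T L U → G.potential ε lam ρ T L U ≤ N →
      (U τ o - L τ o ≤ G.thr ε lam ρ τ → G.potential ε lam ρ T L U < N) →
      Acc (fun c c' => G.Step ε lam ρ c' c) (.explore L U τ o stack) := by
  induction k with
  | zero =>
    refine fun L U τ o stack hk h hN hcut => ⟨_, fun c hc => ?_⟩
    cases hc with
    | descend _ _ _ _ _ hw => exact absurd (h.2 τ hk o) hw.not_ge
    | cutoff _ _ _ _ _ hw => exact acc_back hlam hV hρ ih stack L U h (hcut hw)
  | succ k ihk =>
    refine fun L U τ o stack hk h hN hcut => ⟨_, fun c hc => ?_⟩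
    cases hc with
    | descend _ _ _ _ _ hw β₁ h₁ β₂ h₂ =>
      have hle := G.width_update_le lam L U o
      have h' := h.update hlam hV o
      refine ihk _ _ _ _ _ (by omega) h' ((potential_le hρ T hle).trans hN) fun hw' => ?_
      have hτ : τ < T := lt_of_not_ge fun hτ => (h.2 τ hτ o).not_gt hw
      refine (potential_lt hρ hlam hle h'.1 hτ hw ?_).trans_le hN
      -- The update at depth `τ` has left depth `τ + 1` alone, so the cutoff also bounds the old
      -- width at the child; discounting that bound gives `thr τ - 2 * ρ * lam`.
      rw [updateU_succ, updateL_succ] at hw'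
      rw [← G.gamma_mul_thr_succ hγ]
      exact (h.1.width_update_self_le h₁ h₂).trans (mul_le_mul_of_nonneg_left hw' hγ.le)
    | cutoff _ _ _ _ _ hw => exact acc_back hlam hV hρ ih stack L U h (hcut hw)

theorem acc_loop (hγ : 0 < G.γ) (hlam : 0 < lam) (hV : G.IsLipschitzConst lam) (hρ : 0 < ρ)
    {T : ℕ} (N : ℕ) : ∀ L U, Invariant ε lam ρ T L U → G.potential ε lam ρ T L U = N →
      Acc (fun c c' => G.Step ε lam ρ c' c) (.loop L U) := by
  induction N using Nat.strong_induction_on with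
  | _ N ih =>
    refine fun L U h hN => ⟨_, fun c hc => ?_⟩
    cases hc with
    | startTrial _ _ hw =>
      refine acc_explore hγ hlam hV hρ (fun L U h hlt => ih _ hlt L U h rfl) T L U 0 G.o₀ []
        (by omega) h hN.le fun hcut => ?_
      -- The root has no predecessor, but it cannot be cut off: the loop test and the threshold at
      -- depth `0` are complementary.
      rw [thr_zero] at hcut
      exact absurd hcut hw.not_ge
    | finish => exact ⟨_, fun c hc => by cases hc⟩

end Termination

/-! ### Correctness -/

/-- The bounds held by a configuration are admissible, and they are `ε`-close in the initial
occupancy state if the algorithm has returned them. -/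
def Config.Valid {G : POSG S A₁ A₂ Z₁ Z₂} (ε lam : ℝ) : G.Config → Prop
  | .loop L U => G.IsInit lam L U
  | .explore L U _ _ _ => G.IsInit lam L U
  | .back L U _ => G.IsInit lam L U
  | .done L U => G.IsInit lam L U ∧ U 0 G.o₀ - L 0 G.o₀ ≤ ε

variable {G} [Nonempty A₁] [Nonempty A₂] {ε lam ρ : ℝ}

theorem Step.valid (hlam : 0 < lam) (hV : G.IsLipschitzConst lam) {c c' : G.Config}
    (h : G.Step ε lam ρ c c') (hc : c.Valid ε lam) : c'.Valid ε lam := by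
  cases h with
  | startTrial => exact hc
  | finish _ _ hw => exact ⟨hc, hw⟩
  | descend _ _ _ o => exact IsInit.update hlam.le hV hc o
  | cutoff => exact hc
  | backUpdate _ _ _ o => exact IsInit.update hlam.le hV hc o
  | endTrial => exact hc

theorem Config.Valid.eq_done_of_stuck (hlam : 0 < lam) {c : G.Config} (hc : c.Valid ε lam)
    (h : ∀ c', ¬ G.Step ε lam ρ c c') : ∃ L U, c = .done L U := by
  match c, hc, h with
  | .loop L U, _, h =>
    rcases lt_or_ge ε (U 0 G.o₀ - L 0 G.o₀) with hw | hw
    · exact absurd (.startTrial L U hw) (h _)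
    · exact absurd (.finish L U hw) (h _)
  | .explore L U τ o stack, hc, h =>
    rcases lt_or_ge (G.thr ε lam ρ τ) (U τ o - L τ o) with hw | hw
    · obtain ⟨β₁, h₁⟩ := (IsLip.updateU hlam.le hc.lipU o).exists_isMaximin o
      obtain ⟨β₂, h₂⟩ := (IsLip.updateL hlam.le hc.lipL o).exists_isMinimax o
      exact absurd (.descend L U τ o stack hw β₁ h₁ β₂ h₂) (h _)
    · exact absurd (.cutoff L U τ o stack hw) (h _)
  | .back L U [], _, h => exact absurd (.endTrial L U) (h _)
  | .back L U (⟨τ, o⟩ :: stack), _, h => exact absurd (.backUpdate L U τ o stack) (h _)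
  | .done L U, _, _ => exact ⟨L, U, rfl⟩

end POSG

theorem mainTheorem3 {S A₁ A₂ Z₁ Z₂ : Type*} [Fintype S] [Fintype A₁] [Fintype A₂] [Fintype Z₁]
    [Fintype Z₂] [Nonempty A₁] [Nonempty A₂] (G : POSG S A₁ A₂ Z₁ Z₂) (hγ : 0 < G.γ) :
    -- every subgame has a Nash equilibrium, so that `V*` is its value
    (∀ (τ : ℕ) (o : G.Occ τ), ∃ β₁ β₂, G.IsNash o β₁ β₂ ∧ G.value o β₁ β₂ = G.optValue o) ∧
    -- there are common Lipschitz constants of `V*`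
    (∃ lam₀ : ℝ, ∀ lam, lam₀ ≤ lam → G.IsLipschitzConst lam) ∧
    -- for each of them the algorithm is correct
    ∀ (ε lam ρ : ℝ) (L₀ U₀ : G.ValueFn), 0 < ε → 0 < lam → G.IsLipschitzConst lam →
      0 < ρ → ρ < (1 - G.γ) / (2 * lam) * ε → G.IsInit lam L₀ U₀ →
      -- there is no infinite run
      (¬ ∃ c : ℕ → G.Config, c 0 = .loop L₀ U₀ ∧ ∀ n, G.Step ε lam ρ (c n) (c (n + 1))) ∧
      -- a run can only end by returning bounds `L`, `U`, and these are `ε`-close to `V*_0(o_0)`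
      ∀ c : G.Config, Relation.ReflTransGen (G.Step ε lam ρ) (.loop L₀ U₀) c →
        (∀ c', ¬ G.Step ε lam ρ c c') →
        ∃ L U : G.ValueFn, c = .done L U ∧ L 0 G.o₀ ≤ G.optValue G.o₀ ∧
          G.optValue G.o₀ ≤ U 0 G.o₀ ∧ U 0 G.o₀ - L 0 G.o₀ ≤ ε := by
  refine ⟨fun τ o => G.exists_isNash_value_eq_optValue o, ⟨_, fun lam h => G.isLipschitzConst h⟩,
    fun ε lam ρ L₀ U₀ _ hlam hV hρ hρ' hinit => ⟨?_, fun c hrun hstuck => ?_⟩⟩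
  · rintro ⟨c, hc0, hc⟩
    obtain ⟨W, hW⟩ := hinit.bounded
    obtain ⟨T, hT⟩ := G.exists_forall_le_thr hγ hlam hρ hρ' W
    -- Accessibility of the initial configuration is the right notion: termination is only
    -- established from admissible bounds.
    refine (not_acc_iff_exists_descending_chain (r := fun c c' => G.Step ε lam ρ c' c)).2
      ⟨c, hc0, hc⟩ ?_
    exact POSG.acc_loop hγ hlam hV hρ _ L₀ U₀ ⟨hinit, fun τ hτ o => (hW τ o).trans (hT τ hτ)⟩ rfl
  · have hval : c.Valid ε lam := by
      clear hstuck
      induction hrun with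
      | refl => exact hinit
      | tail _ hs ih => exact hs.valid hlam hV ih
    obtain ⟨L, U, rfl⟩ := hval.eq_done_of_stuck hlam hstuck
    exact ⟨L, U, rfl, hval.1.lower 0 G.o₀, hval.1.upper 0 G.o₀, hval.2⟩
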